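/- Let $N\in\mathbb N$ and let $A_1,\dots,A_N$ be non-negative random variables on a probability space such that $$P\Big\{\sum_{i=1}^N \mathbf 1\{A_i>0\}\in\{0,1\}\Big\}<1,\qquad \mathbb E\Big[\sum_{i=1}^N \mathbf 1\{A_i>0\}\Big]>1,\qquad P\{A_i\in\{0,1\}\ \text{for all } i=1,\dots,N\}<1 .$$ Put $Q(s)=\mathbb E\big[\sum_{j=1}^N A_j^s\big]-1\in[-1,\infty]$ for $s\ge 0$ (with the convention $0^0=0$) and $\mu(s)=Q(s)/s$ for $s>0$. Fix $\gamma\in(0,2]$ and assume that $\mu(\delta)<\mu(\gamma)<\infty$ for some $\delta>\gamma$. Then: (i) There is a unique probability distribution $\zeta_{\infty,\gamma}$ on $\mathbb R^+=[0,\infty)$ with $\int_{\mathbb R^+} z\,\zeta_{\infty,\gamma}(dz)=1$ whose characteristic function $v(\xi)=\int e^{i\xi z}\,\zeta_{\infty,\gamma}(dz)$ solves $$v(\xi)=\int_0^1 \mathbb E\Big[\prod_{i=1}^N v\big(\xi A_i^\gamma \tau^{Q(\gamma)}\big)\Big]\,d\tau\qquad(\xi\in\mathbb R).$$ (ii) The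 equation $\mu(q)=\mu(\gamma)$ has at most one solution $q=q^*_\gamma\neq\gamma$ in $(0,\infty)$; set $q^*_\gamma:=+\infty$ if $q=\gamma$ is the only solution. (iii) $\zeta_{\infty,\gamma}$ is degenerate (a point mass) if and only if $\sum_{i=1}^N A_i^\gamma=1$ almost surely. Moreover, if $P\{\sum_{i=1}^N A_i^\gamma=1\}<1$ and $p>\gamma$, then $\int_{\mathbb R^+} z^{p/\gamma}\,\zeta_{\infty,\gamma}(dz)<\infty$ if and only if $p<q^*_\gamma$ and $\mu(p)<\infty$ (the condition $\mu(p)<\infty$ is implied by $p<q^*_\gamma$ when $q^*_\gamma<\infty$). -/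

import Mathlib

open MeasureTheory
open scoped ENNReal

noncomputable section

namespace KacLike

variable {Ω : Type*} [MeasurableSpace Ω] {N : ℕ}

/-- The number of indices `i` with `A i ω > 0`. -/
def posCount (A : Fin N → Ω → ℝ) (ω : Ω) : ℕ :=
  ∑ i, if 0 < A i ω then 1 else 0

/-- The standing assumptions on the random weights `A 0, …, A (N - 1)`: they are non-negative random
variables, the number of positive ones is not almost surely `0` or `1` and has mean larger than `1`,
and they are not almost surely all in `{0, 1}`. -/
structure StandingAssumptions (P : Measure Ω) (A : Fin N → Ω → ℝ) : Prop where
  measurable : ∀ i, Measurable (A i)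
  nonneg : ∀ i ω, 0 ≤ A i ω
  count_not_trivial : P {ω | posCount A ω = 0 ∨ posCount A ω = 1} < 1
  one_lt_mean_count : 1 < ∫⁻ ω, (posCount A ω : ℝ≥0∞) ∂P
  not_zero_one : P {ω | ∀ i, A i ω = 0 ∨ A i ω = 1} < 1

/-- `E [∑ j, A j ^ s]` in `[0, ∞]`, for non-negative `A j`, with the convention `0 ^ 0 = 0`. -/
def momentSum (P : Measure Ω) (A : Fin N → Ω → ℝ) (s : ℝ) : ℝ≥0∞ :=
  ∫⁻ ω, ∑ j, (if 0 < A j ω then ENNReal.ofReal (A j ω ^ s) else 0) ∂P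

/-- The convex function `Q s = E [∑ j, A j ^ s] - 1`, with values in `[-1, ∞]`. -/
def Q (P : Measure Ω) (A : Fin N → Ω → ℝ) (s : ℝ) : EReal :=
  (momentSum P A s : EReal) - 1

/-- The spectral function `μ s = Q s / s`, for `s > 0`, with values in `(-∞, ∞]`. -/
def spectral (P : Measure Ω) (A : Fin N → Ω → ℝ) (s : ℝ) : EReal :=
  Q P A s / (s : EReal)

/-- The integral equation
`v ξ = ∫_0^1 E [∏ i, v (ξ * A i ^ γ * τ ^ Q γ)] dτ` for all real `ξ`
(to be used when `Q γ` is finite). -/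
def SolvesEq (P : Measure Ω) (A : Fin N → Ω → ℝ) (γ : ℝ) (v : ℝ → ℂ) : Prop :=
  ∀ ξ : ℝ, v ξ = ∫ τ in (0 : ℝ)..1,
    ∫ ω, ∏ i, v (ξ * A i ω ^ γ * τ ^ (Q P A γ).toReal) ∂P

/-- `ζ` is a probability measure on `[0, ∞)` with mean one whose characteristic function solves
the integral equation. -/
structure IsMeanOneSolution (P : Measure Ω) (A : Fin N → Ω → ℝ) (γ : ℝ) (ζ : Measure ℝ) :
    Prop where
  isProbabilityMeasure : IsProbabilityMeasure ζ
  supported : ζ (Set.Iio 0) = 0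
  integrable : Integrable (fun z : ℝ => z) ζ
  mean_eq_one : ∫ z, z ∂ζ = 1
  solves : SolvesEq P A γ (charFun ζ)

/-- The solutions `q ≠ γ`, `q > 0`, of the equation `μ q = μ γ`. -/
def otherRoots (P : Measure Ω) (A : Fin N → Ω → ℝ) (γ : ℝ) : Set ℝ :=
  {q | 0 < q ∧ q ≠ γ ∧ spectral P A q = spectral P A γ}

/-- The solution `q ≠ γ` of `μ q = μ γ` (there is at most one), and `∞` if there is none. -/
def qStar (P : Measure Ω) (A : Fin N → Ω → ℝ) (γ : ℝ) : EReal :=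
  sInf ((fun q : ℝ => (q : EReal)) '' otherRoots P A γ)

end KacLike

end

/-! Let τ be uniform on (0, 1], independent of the A_i, and put T_i = A_i^γ τ^{Q(γ)}. The equation
for v says that the law ζ is a fixed point of the smoothing transform Z ↦ ∑ T_i Z_i, with
independent copies Z_i of Z. Since E τ^{Q(γ)} = 1/(Q(γ)+1), the weights satisfy E ∑ T_i = 1. For p >
0, E ∑ T_i^{p/γ} < 1 is equivalent to μ(p) < μ(γ) (`weightMoment_lt_one_iff`), so δ provides an
exponent s = δ/γ > 1 with E ∑ T_i^s < 1, and by convexity such an exponent r ≤ 2.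

For laws of mean one, characteristic functions agree to first order at 0, and the transform
multiplies an error |ξ|^r by E ∑ T_i^r < 1 (`norm_charFun_sub_smoothing_le`). This contraction gives
uniqueness, and convergence of the iterates started at the point mass at one.

For s > 1, (∑ T_i Z_i)^s exceeds ∑ (T_i Z_i)^s only by cross terms of lower order in each Z_i, so E
∑ T_i^s < 1 bounds the s-th moments of the iterates (`exists_moment_iterates_le`). Conversely x ↦
x^s is strictly superadditive and two weights are positive with positive probability, so a finite
s-th moment of the fixed point forces E ∑ T_i^s < 1 (`weightMoment_lt_one_of_moment_lt_top`).

Finally s ↦ Q(s) - s μ(γ) is convex, vanishes at γ and is negative at δ. Hence it has at most one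
other zero, and this zero bounds the set of p > γ with μ(p) < μ(γ). A degenerate solution must be
the point mass at one, which is fixed exactly when ∑ T_i = 1 almost surely. -/

namespace SmoothingTransform

/-! ### Elementary inequalities for powers, exponentials and products. -/

section Inequalities

variable {ι : Type*} [Fintype ι]

/-- With x_m maximal and S the sum, Bernoulli's inequality at x_m / S gives S^s - x_m^s ≤ s S^(s-1)
(S - x_m), and S is at most the cardinality times x_m. The cross terms have degree s - 1 in one
variable and 1 in another, so for independent variables of mean one they involve only moments of
order s - 1. -/
lemma sum_rpow_le_sum_rpow_add_cross [DecidableEq ι] {s : ℝ} (hs : 1 ≤ s) {x : ι → ℝ}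
    (hx : ∀ i, 0 ≤ x i) :
    (∑ i, x i) ^ s ≤ ∑ i, x i ^ s
      + s * (Fintype.card ι : ℝ) ^ (s - 1) *
        ∑ i, ∑ j ∈ Finset.univ.erase i, x i ^ (s - 1) * x j := by
  have hs0 : 0 < s := by linarith
  have hcross : 0 ≤ ∑ i, ∑ j ∈ Finset.univ.erase i, x i ^ (s - 1) * x j :=
    Finset.sum_nonneg fun i _ => Finset.sum_nonneg fun j _ =>
      mul_nonneg (Real.rpow_nonneg (hx i) _) (hx j)
  have hpow : 0 ≤ ∑ i, x i ^ s := Finset.sum_nonneg fun i _ => Real.rpow_nonneg (hx i) _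
  have hcard : 0 ≤ (Fintype.card ι : ℝ) ^ (s - 1) := Real.rpow_nonneg (by positivity) _
  rcases (Finset.sum_nonneg fun i _ => hx i).eq_or_lt with h0 | hpos
  · rw [← h0, Real.zero_rpow hs0.ne']
    positivity
  have hne : (Finset.univ : Finset ι).Nonempty := by
    by_contra h
    rw [Finset.not_nonempty_iff_eq_empty] at h
    simp [h] at hpos
  obtain ⟨m, -, hm⟩ := Finset.exists_max_image Finset.univ x hne
  set S := ∑ i, x i with hS
  have hR : S - x m = ∑ j ∈ Finset.univ.erase m, x j := by
    rw [hS, ← Finset.add_sum_erase _ _ (Finset.mem_univ m)]; ring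
  have hR0 : 0 ≤ S - x m := by rw [hR]; exact Finset.sum_nonneg fun j _ => hx j
  have hSM : S ≤ Fintype.card ι * x m := by
    have := Finset.sum_le_card_nsmul Finset.univ x (x m) hm
    simpa [nsmul_eq_mul] using this
  have hSs : S ^ s = S ^ (s - 1) * S := by
    rw [← Real.rpow_add_one hpos.ne']; ring_nf
  have hbern : S ^ s - s * (S ^ (s - 1) * (S - x m)) ≤ x m ^ s := by
    have h := one_add_mul_self_le_rpow_one_add (s := x m / S - 1) (p := s)
      (by have := div_nonneg (hx m) hpos.le; linarith) hs
    have h2 : x m ^ s = S ^ s * (1 + (x m / S - 1)) ^ s := by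
      rw [add_sub_cancel, Real.div_rpow (hx m) hpos.le]
      field_simp
    rw [h2]
    have h3 : S ^ s - s * (S ^ (s - 1) * (S - x m)) = S ^ s * (1 + s * (x m / S - 1)) := by
      rw [hSs]; field_simp; ring
    rw [h3]
    exact mul_le_mul_of_nonneg_left h (Real.rpow_nonneg hpos.le _)
  have hSpow : S ^ (s - 1) ≤ (Fintype.card ι : ℝ) ^ (s - 1) * x m ^ (s - 1) := by
    rw [← Real.mul_rpow (by positivity) (hx m)]
    exact Real.rpow_le_rpow hpos.le hSM (by linarith)
  have h1 : x m ^ s ≤ ∑ i, x i ^ s :=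
    Finset.single_le_sum (f := fun i => x i ^ s) (fun i _ => Real.rpow_nonneg (hx i) _)
      (Finset.mem_univ m)
  have h2 : x m ^ (s - 1) * (S - x m)
      ≤ ∑ i, ∑ j ∈ Finset.univ.erase i, x i ^ (s - 1) * x j := by
    rw [hR, Finset.mul_sum]
    exact Finset.single_le_sum (f := fun i => ∑ j ∈ Finset.univ.erase i, x i ^ (s - 1) * x j)
      (fun i _ => Finset.sum_nonneg fun j _ =>
        mul_nonneg (Real.rpow_nonneg (hx i) _) (hx j)) (Finset.mem_univ m)
  have h3 : S ^ (s - 1) * (S - x m) ≤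
      (Fintype.card ι : ℝ) ^ (s - 1) * ∑ i, ∑ j ∈ Finset.univ.erase i, x i ^ (s - 1) * x j :=
    calc _ ≤ (Fintype.card ι : ℝ) ^ (s - 1) * x m ^ (s - 1) * (S - x m) :=
          mul_le_mul_of_nonneg_right hSpow hR0
      _ = (Fintype.card ι : ℝ) ^ (s - 1) * (x m ^ (s - 1) * (S - x m)) := by ring
      _ ≤ _ := mul_le_mul_of_nonneg_left h2 hcard
  have h4 := mul_le_mul_of_nonneg_left h3 hs0.le
  linarith

lemma rpow_eq_mul_rpow_sub_one {s x : ℝ} (hs : 1 < s) (hx : 0 ≤ x) :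
    x ^ s = x * x ^ (s - 1) := by
  rcases hx.eq_or_lt with rfl | h
  · simp [Real.zero_rpow (by linarith : s ≠ 0)]
  · rw [mul_comm, ← Real.rpow_add_one h.ne']; ring_nf

lemma sum_rpow_le_rpow_sum {s : ℝ} (hs : 1 < s) {x : ι → ℝ} (hx : ∀ i, 0 ≤ x i) :
    ∑ i, x i ^ s ≤ (∑ i, x i) ^ s := by
  rw [rpow_eq_mul_rpow_sub_one hs (Finset.sum_nonneg fun i _ => hx i), Finset.sum_mul]
  refine Finset.sum_le_sum fun i _ => ?_
  rw [rpow_eq_mul_rpow_sub_one hs (hx i)]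
  exact mul_le_mul_of_nonneg_left (Real.rpow_le_rpow (hx i)
    (Finset.single_le_sum (fun i _ => hx i) (Finset.mem_univ i)) (by linarith)) (hx i)

lemma sum_rpow_lt_rpow_sum {s : ℝ} (hs : 1 < s) {x : ι → ℝ} (hx : ∀ i, 0 ≤ x i) {k l : ι}
    (hkl : k ≠ l) (hk : 0 < x k) (hl : 0 < x l) :
    ∑ i, x i ^ s < (∑ i, x i) ^ s := by
  classical
  rw [rpow_eq_mul_rpow_sub_one hs (Finset.sum_nonneg fun i _ => hx i), Finset.sum_mul]
  have hle : ∀ i, x i ≤ ∑ i, x i := fun i =>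
    Finset.single_le_sum (fun i _ => hx i) (Finset.mem_univ i)
  refine Finset.sum_lt_sum (fun i _ => ?_) ⟨k, Finset.mem_univ k, ?_⟩
  · rw [rpow_eq_mul_rpow_sub_one hs (hx i)]
    exact mul_le_mul_of_nonneg_left (Real.rpow_le_rpow (hx i) (hle i) (by linarith)) (hx i)
  · rw [rpow_eq_mul_rpow_sub_one hs (hx k)]
    refine mul_lt_mul_of_pos_left (Real.rpow_lt_rpow (hx k) ?_ (by linarith)) hk
    rw [← Finset.add_sum_erase _ _ (Finset.mem_univ k)]
    have := Finset.single_le_sum (f := x) (fun i _ => hx i)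
      (Finset.mem_erase.2 ⟨hkl.symm, Finset.mem_univ l⟩)
    linarith

lemma rpow_sub_one_mul_le {s : ℝ} (hs : 1 < s) {a b : ℝ} (ha : 0 ≤ a) (hb : 0 ≤ b) :
    a ^ (s - 1) * b ≤ a ^ s + b ^ s := by
  rcases le_total a b with h | h
  · have h1 : a ^ (s - 1) * b ≤ b * b ^ (s - 1) := by
      rw [mul_comm]
      exact mul_le_mul_of_nonneg_left (Real.rpow_le_rpow ha h (by linarith)) hb
    rw [rpow_eq_mul_rpow_sub_one hs hb]
    linarith [Real.rpow_nonneg ha s]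
  · rw [rpow_eq_mul_rpow_sub_one hs ha, mul_comm]
    have := mul_le_mul_of_nonneg_right h (Real.rpow_nonneg ha (s - 1))
    linarith [Real.rpow_nonneg hb s]

/-- Split at z = ε⁻¹. This lets a moment of order s - 1 be absorbed into the moment of order s with
a small coefficient. -/
lemma rpow_sub_one_le {s : ℝ} (hs : 1 < s) {ε z : ℝ} (hε : 0 < ε) (hz : 0 ≤ z) :
    z ^ (s - 1) ≤ ε * z ^ s + (ε⁻¹) ^ (s - 1) := by
  have h1 : 0 ≤ (ε⁻¹) ^ (s - 1) := Real.rpow_nonneg (by positivity) _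
  have h2 : 0 ≤ ε * z ^ s := mul_nonneg hε.le (Real.rpow_nonneg hz _)
  rcases le_total z ε⁻¹ with h | h
  · linarith [Real.rpow_le_rpow hz h (by linarith : 0 ≤ s - 1)]
  · have h3 : 1 ≤ ε * z := by
      have := mul_le_mul_of_nonneg_left h hε.le
      rwa [mul_inv_cancel₀ hε.ne'] at this
    have h4 := mul_le_mul_of_nonneg_right h3 (Real.rpow_nonneg hz (s - 1))
    rw [rpow_eq_mul_rpow_sub_one hs hz]
    linarith

lemma rpow_convexComb_le {a x y t : ℝ} (ha : 0 < a) (ht0 : 0 ≤ t) (ht1 : t ≤ 1) :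
    a ^ ((1 - t) * x + t * y) ≤ (1 - t) * a ^ x + t * a ^ y := by
  rw [Real.rpow_add ha, mul_comm (1 - t) x, mul_comm t y, Real.rpow_mul ha.le, Real.rpow_mul ha.le]
  exact Real.geom_mean_le_arith_mean2_weighted (by linarith) ht0 (Real.rpow_nonneg ha.le _)
    (Real.rpow_nonneg ha.le _) (by ring)

lemma norm_exp_sub_one_sub_le_two_mul (x : ℝ) :
    ‖Complex.exp (x * Complex.I) - 1 - x * Complex.I‖ ≤ 2 * |x| := by
  have h := Real.norm_exp_I_mul_ofReal_sub_one_le (x := x)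
  rw [mul_comm] at h
  calc _ ≤ ‖Complex.exp (x * Complex.I) - 1‖ + ‖(x : ℂ) * Complex.I‖ := norm_sub_le _ _
    _ ≤ |x| + |x| := by
        gcongr
        · simpa using h
        · simp
    _ = 2 * |x| := by ring

/-- The quadratic Taylor bound serves for |x| ≤ 1 and the linear bound for |x| ≥ 1; the exponent s
lies between theirs. -/
lemma norm_exp_sub_one_sub_le_rpow {s : ℝ} (hs1 : 1 ≤ s) (hs2 : s ≤ 2) (x : ℝ) :
    ‖Complex.exp (x * Complex.I) - 1 - x * Complex.I‖ ≤ 2 * |x| ^ s := by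
  rcases le_total |x| 1 with h | h
  · have h1 : ‖(x : ℂ) * Complex.I‖ ≤ 1 := by simpa using h
    have h2 := Complex.norm_exp_sub_one_sub_id_le h1
    refine h2.trans ?_
    have h3 : ‖(x : ℂ) * Complex.I‖ ^ 2 = |x| ^ (2 : ℝ) := by simp
    rw [h3]
    have h4 : |x| ^ (2 : ℝ) ≤ |x| ^ s := by
      rcases (abs_nonneg x).eq_or_lt with h0 | h0
      · rw [← h0, Real.zero_rpow, Real.zero_rpow] <;> linarith
      · exact Real.rpow_le_rpow_of_exponent_ge h0 h hs2
    linarith [Real.rpow_nonneg (abs_nonneg x) s]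
  · refine (norm_exp_sub_one_sub_le_two_mul x).trans ?_
    have := Real.rpow_le_rpow_of_exponent_le h hs1
    rw [Real.rpow_one] at this
    linarith

lemma norm_prod_sub_prod_le (f g : ι → ℂ) (hf : ∀ i, ‖f i‖ ≤ 1) (hg : ∀ i, ‖g i‖ ≤ 1) :
    ‖∏ i, f i - ∏ i, g i‖ ≤ ∑ i, ‖f i - g i‖ := by
  classical
  suffices h : ∀ t : Finset ι, ‖∏ i ∈ t, f i - ∏ i ∈ t, g i‖ ≤ ∑ i ∈ t, ‖f i - g i‖ from h _
  intro t
  induction t using Finset.induction_on with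
  | empty => simp
  | insert a t ha ih =>
    rw [Finset.prod_insert ha, Finset.prod_insert ha, Finset.sum_insert ha]
    have hgt : ‖∏ i ∈ t, g i‖ ≤ 1 := by
      rw [norm_prod]
      exact Finset.prod_le_one (fun i _ => norm_nonneg _) fun i _ => hg i
    calc _ = ‖f a * (∏ i ∈ t, f i - ∏ i ∈ t, g i) + (f a - g a) * ∏ i ∈ t, g i‖ := by ring_nf
      _ ≤ ‖f a * (∏ i ∈ t, f i - ∏ i ∈ t, g i)‖ + ‖(f a - g a) * ∏ i ∈ t, g i‖ :=
          norm_add_le _ _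
      _ ≤ 1 * ∑ i ∈ t, ‖f i - g i‖ + ‖f a - g a‖ * 1 := by
          rw [norm_mul, norm_mul]
          gcongr
          exact hf a
      _ = _ := by ring

end Inequalities

/-- The moment `∫ z ^ s dζ` in `[0, ∞]`. -/
noncomputable def moment (ζ : Measure ℝ) (s : ℝ) : ℝ≥0∞ :=
  ∫⁻ z, ENNReal.ofReal (z ^ s) ∂ζ

/-- Probability measures on `[0, ∞)` with mean one. -/
structure IsMeanOne (ζ : Measure ℝ) : Prop where
  isProbabilityMeasure : IsProbabilityMeasure ζ
  nonneg : ∀ᵐ z ∂ζ, 0 ≤ z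
  mean : moment ζ 1 = 1

/-! ### Moments and first-order expansion of characteristic functions. -/

section Moments

variable {ζ : Measure ℝ}

lemma integrable_rpow_of_moment_lt_top {s : ℝ} (h0 : ∀ᵐ z ∂ζ, 0 ≤ z) (h : moment ζ s < ⊤) :
    Integrable (fun z => z ^ s) ζ := by
  refine ⟨by fun_prop, ?_⟩
  rw [hasFiniteIntegral_iff_ofReal]
  · exact h
  · filter_upwards [h0] with z hz using Real.rpow_nonneg hz s

lemma integral_rpow_eq {s : ℝ} (h0 : ∀ᵐ z ∂ζ, 0 ≤ z) :
    ∫ z, z ^ s ∂ζ = (moment ζ s).toReal := by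
  rw [integral_eq_lintegral_of_nonneg_ae _ (by fun_prop)]
  · rfl
  · filter_upwards [h0] with z hz using Real.rpow_nonneg hz s

lemma moment_one_lt_top [IsProbabilityMeasure ζ] {s : ℝ} (hs : 1 ≤ s) (h0 : ∀ᵐ z ∂ζ, 0 ≤ z)
    (h : moment ζ s < ⊤) : moment ζ 1 < ⊤ := by
  have hle : moment ζ 1 ≤ ∫⁻ z, (1 + ENNReal.ofReal (z ^ s)) ∂ζ := by
    refine lintegral_mono_ae ?_
    filter_upwards [h0] with z hz
    rw [← ENNReal.ofReal_one, ← ENNReal.ofReal_add zero_le_one (Real.rpow_nonneg hz s)]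
    refine ENNReal.ofReal_le_ofReal ?_
    rw [Real.rpow_one]
    rcases le_total z 1 with h1 | h1
    · linarith [Real.rpow_nonneg hz s]
    · have := Real.rpow_le_rpow_of_exponent_le h1 hs
      rw [Real.rpow_one] at this
      linarith
  refine hle.trans_lt ?_
  rw [lintegral_add_left measurable_const]
  simpa [moment] using h

lemma norm_charFun_sub_le_integral (hint : Integrable (fun z : ℝ => z) ζ) [IsProbabilityMeasure ζ]
    (ξ : ℝ) :
    ‖charFun ζ ξ - 1 - ξ * (∫ z, z ∂ζ : ℝ) * Complex.I‖
      ≤ ∫ z, ‖Complex.exp ((ξ * z : ℝ) * Complex.I) - 1 - (ξ * z : ℝ) * Complex.I‖ ∂ζ := by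
  have he : Integrable (fun z : ℝ => Complex.exp ((ξ * z : ℝ) * Complex.I)) ζ := by
    refine Integrable.of_bound (by fun_prop) 1 (Filter.Eventually.of_forall fun z => ?_)
    rw [Complex.norm_exp_ofReal_mul_I]
  have hl : Integrable (fun z : ℝ => ((ξ * z : ℝ) : ℂ) * Complex.I) ζ :=
    ((hint.const_mul ξ).ofReal).mul_const _
  have key : charFun ζ ξ - 1 - ξ * (∫ z, z ∂ζ : ℝ) * Complex.I
      = ∫ z, (Complex.exp ((ξ * z : ℝ) * Complex.I) - 1 - (ξ * z : ℝ) * Complex.I) ∂ζ := by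
    rw [integral_sub (f := fun z : ℝ => Complex.exp ((ξ * z : ℝ) * Complex.I) - 1)
        (he.sub (integrable_const _)) hl, integral_sub he (integrable_const _),
      integral_mul_const, integral_complex_ofReal, integral_const_mul, charFun_apply_real]
    simp
  rw [key]
  exact norm_integral_le_integral_norm _

lemma norm_charFun_sub_le_rpow [IsProbabilityMeasure ζ] {s : ℝ} (hs1 : 1 ≤ s) (hs2 : s ≤ 2)
    (h0 : ∀ᵐ z ∂ζ, 0 ≤ z) (h : moment ζ s < ⊤) (ξ : ℝ) :
    ‖charFun ζ ξ - 1 - ξ * (moment ζ 1).toReal * Complex.I‖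
      ≤ 2 * (moment ζ s).toReal * |ξ| ^ s := by
  have h1 : Integrable (fun z : ℝ => z) ζ := by
    simpa using integrable_rpow_of_moment_lt_top h0 (moment_one_lt_top hs1 h0 h)
  have hmean : ∫ z, z ∂ζ = (moment ζ 1).toReal := by simpa using integral_rpow_eq (s := 1) h0
  rw [← hmean]
  refine (norm_charFun_sub_le_integral h1 ξ).trans ?_
  calc _ ≤ ∫ z, 2 * |ξ| ^ s * z ^ s ∂ζ := by
        refine integral_mono_of_nonneg (Filter.Eventually.of_forall fun z => norm_nonneg _)
          ((integrable_rpow_of_moment_lt_top h0 h).const_mul _) ?_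
        filter_upwards [h0] with z hz
        refine (norm_exp_sub_one_sub_le_rpow hs1 hs2 _).trans ?_
        rw [abs_mul, Real.mul_rpow (abs_nonneg _) (abs_nonneg _), abs_of_nonneg hz, mul_assoc]
    _ = _ := by rw [integral_const_mul, integral_rpow_eq h0]; ring

lemma exists_integral_indicator_Ioi_le (h1 : Integrable (fun z : ℝ => z) ζ) {ε : ℝ} (hε : 0 < ε) :
    ∃ K : ℝ, 0 ≤ K ∧ ∫ z, (Set.Ioi K).indicator (fun z => z) z ∂ζ ≤ ε := by
  have hlim : Filter.Tendsto (fun n : ℕ => ∫ z, (Set.Ioi (n : ℝ)).indicator (fun z => z) z ∂ζ)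
      Filter.atTop (nhds (∫ _, (0 : ℝ) ∂ζ)) := by
    refine tendsto_integral_of_dominated_convergence (fun z => |z|)
      (fun n => (measurable_id.indicator measurableSet_Ioi).aestronglyMeasurable) h1.abs
      (fun n => Filter.Eventually.of_forall fun z => ?_)
      (Filter.Eventually.of_forall fun z => ?_)
    · exact norm_indicator_le_norm_self (fun z : ℝ => z) z
    · refine tendsto_const_nhds.congr' ?_
      obtain ⟨m, hm⟩ := exists_nat_ge z
      filter_upwards [Filter.eventually_ge_atTop m] with n hn
      rw [Set.indicator_of_notMem]
      simp only [Set.mem_Ioi, not_lt]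
      exact hm.trans (by exact_mod_cast hn)
  rw [integral_zero] at hlim
  obtain ⟨n, hn⟩ := (hlim.eventually (ge_mem_nhds hε)).exists
  exact ⟨n, by positivity, hn⟩

lemma IsMeanOne.integrable (h : IsMeanOne ζ) : Integrable (fun z : ℝ => z) ζ := by
  simpa using integrable_rpow_of_moment_lt_top (s := 1) h.nonneg (by simp [h.mean])

lemma IsMeanOne.integral_eq (h : IsMeanOne ζ) : ∫ z, z ∂ζ = 1 := by
  simpa [h.mean] using integral_rpow_eq (s := 1) h.nonneg

/-- No moment above the first is assumed. Beyond a truncation level K the linear bound meets a small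
tail of the mean; below K the power bound costs K^s. Uniqueness among all laws of mean one rests on
this. -/
lemma IsMeanOne.exists_norm_charFun_sub_le (h : IsMeanOne ζ) {s : ℝ} (hs1 : 1 ≤ s) (hs2 : s ≤ 2)
    {ε : ℝ} (hε : 0 < ε) :
    ∃ C : ℝ, 0 ≤ C ∧ ∀ ξ : ℝ, ‖charFun ζ ξ - 1 - ξ * Complex.I‖ ≤ ε * |ξ| + C * |ξ| ^ s := by
  have := h.isProbabilityMeasure
  obtain ⟨K, hK0, hK⟩ := exists_integral_indicator_Ioi_le h.integrable (half_pos hε)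
  refine ⟨2 * K ^ s, by positivity, fun ξ => ?_⟩
  have h2 := norm_charFun_sub_le_integral h.integrable ξ
  rw [h.integral_eq] at h2
  simp only [Complex.ofReal_one, mul_one] at h2
  refine h2.trans ?_
  have hind : Integrable ((Set.Ioi K).indicator fun z : ℝ => z) ζ :=
    h.integrable.indicator measurableSet_Ioi
  calc _ ≤ ∫ z, (2 * |ξ| * (Set.Ioi K).indicator (fun z => z) z + 2 * K ^ s * |ξ| ^ s) ∂ζ := by
        refine integral_mono_of_nonneg (Filter.Eventually.of_forall fun z => norm_nonneg _)
          ((hind.const_mul _).add (integrable_const _)) ?_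
        filter_upwards [h.nonneg] with z hz
        by_cases hzK : K < z
        · rw [Set.indicator_of_mem (by exact hzK)]
          refine (norm_exp_sub_one_sub_le_two_mul _).trans ?_
          rw [abs_mul, abs_of_nonneg hz]
          have : 0 ≤ 2 * K ^ s * |ξ| ^ s := by positivity
          linarith
        · rw [Set.indicator_of_notMem (by exact hzK)]
          refine (norm_exp_sub_one_sub_le_rpow hs1 hs2 _).trans ?_
          rw [abs_mul, abs_of_nonneg hz, Real.mul_rpow (abs_nonneg _) hz]
          have h3 := Real.rpow_le_rpow hz (not_lt.1 hzK) (by linarith : 0 ≤ s)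
          have h4 := mul_le_mul_of_nonneg_left h3 (Real.rpow_nonneg (abs_nonneg ξ) s)
          linarith
    _ = 2 * |ξ| * ∫ z, (Set.Ioi K).indicator (fun z => z) z ∂ζ + 2 * K ^ s * |ξ| ^ s := by
        rw [integral_add (hind.const_mul _) (integrable_const _), integral_const_mul]
        simp
    _ ≤ ε * |ξ| + 2 * K ^ s * |ξ| ^ s := by
        have := mul_le_mul_of_nonneg_left hK (by positivity : 0 ≤ 2 * |ξ|)
        linarith

end Moments

/-! ### The smoothing transform, its contraction property and uniqueness. -/

section Transform

variable {Ω : Type*} [MeasurableSpace Ω] {ι : Type*} [Fintype ι]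

/-- The law of `∑ i, T i * Z i`, with the `Z i` independent of law `ζ` and independent of `T`. -/
noncomputable def smoothing (P : Measure Ω) (T : ι → Ω → ℝ) (ζ : Measure ℝ) : Measure ℝ :=
  (P.prod (Measure.pi fun _ : ι => ζ)).map fun x => ∑ i, T i x.1 * x.2 i

/-- The weight moment `E [∑ i, T i ^ s]` in `[0, ∞]`. -/
noncomputable def weightMoment (P : Measure Ω) (T : ι → Ω → ℝ) (s : ℝ) : ℝ≥0∞ :=
  ∫⁻ ω, ∑ i, ENNReal.ofReal (T i ω ^ s) ∂P

/-- Non-negative random weights with `E [∑ i, T i] = 1`. -/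
structure IsNormalizedWeights (P : Measure Ω) (T : ι → Ω → ℝ) : Prop where
  measurable : ∀ i, Measurable (T i)
  nonneg : ∀ i ω, 0 ≤ T i ω
  weightMoment_one : weightMoment P T 1 = 1

variable {P : Measure Ω} {T : ι → Ω → ℝ}

lemma measurable_weightedSum (hT : ∀ i, Measurable (T i)) :
    Measurable fun x : Ω × (ι → ℝ) => ∑ i, T i x.1 * x.2 i :=
  Finset.measurable_sum _ fun i _ =>
    ((hT i).comp measurable_fst).mul ((measurable_pi_apply i).comp measurable_snd)

lemma isProbabilityMeasure_smoothing [IsProbabilityMeasure P] (hT : ∀ i, Measurable (T i)) (ζ : Measure ℝ)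
    [IsProbabilityMeasure ζ] : IsProbabilityMeasure (smoothing P T ζ) :=
  Measure.isProbabilityMeasure_map (measurable_weightedSum hT).aemeasurable

lemma lintegral_smoothing (hT : ∀ i, Measurable (T i)) (ζ : Measure ℝ) [IsProbabilityMeasure ζ]
    {f : ℝ → ℝ≥0∞} (hf : Measurable f) :
    ∫⁻ z, f z ∂smoothing P T ζ
      = ∫⁻ ω, ∫⁻ z, f (∑ i, T i ω * z i) ∂(Measure.pi fun _ : ι => ζ) ∂P := by
  rw [smoothing, lintegral_map hf (measurable_weightedSum hT), lintegral_prod]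
  exact (hf.comp (measurable_weightedSum hT)).aemeasurable

lemma charFun_smoothing [IsProbabilityMeasure P] (hT : ∀ i, Measurable (T i)) (ζ : Measure ℝ) [IsProbabilityMeasure ζ]
    (ξ : ℝ) : charFun (smoothing P T ζ) ξ = ∫ ω, ∏ i, charFun ζ (ξ * T i ω) ∂P := by
  have hm := measurable_weightedSum hT
  rw [charFun_apply_real, smoothing, integral_map hm.aemeasurable (by fun_prop), integral_prod]
  · refine integral_congr_ae (Filter.Eventually.of_forall fun ω => ?_)
    simp only
    have : ∀ z : ι → ℝ, Complex.exp (ξ * (∑ i, T i ω * z i : ℝ) * Complex.I)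
        = ∏ i, Complex.exp ((ξ * T i ω : ℝ) * z i * Complex.I) := by
      intro z
      rw [← Complex.exp_sum]
      congr 1
      push_cast
      rw [Finset.mul_sum, Finset.sum_mul]
      exact Finset.sum_congr rfl fun i _ => by ring
    simp_rw [this, charFun_apply_real]
    exact integral_fintype_prod_eq_prod
      (f := fun i (z : ℝ) => Complex.exp ((ξ * T i ω : ℝ) * z * Complex.I))
  · refine Integrable.of_bound (C := 1) (Measurable.aestronglyMeasurable (by fun_prop))
      (Filter.Eventually.of_forall fun x => ?_)
    rw [← Complex.ofReal_mul, Complex.norm_exp_ofReal_mul_I]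

/-- A difference of products in the unit disc is at most the sum of the differences. Scaling by T_i
then leaves `a` unchanged, because E ∑ T_i = 1, and multiplies `b` by E ∑ T_i^s. -/
lemma norm_charFun_sub_smoothing_le [IsProbabilityMeasure P] (hT : IsNormalizedWeights P T) {s : ℝ}
    (hs : weightMoment P T s < ⊤) {μ ν : Measure ℝ} [IsProbabilityMeasure μ]
    [IsProbabilityMeasure ν] {a b : ℝ}
    (h : ∀ ξ : ℝ, ‖charFun μ ξ - charFun ν ξ‖ ≤ a * |ξ| + b * |ξ| ^ s) (ξ : ℝ) :
    ‖charFun (smoothing P T μ) ξ - charFun (smoothing P T ν) ξ‖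
      ≤ a * |ξ| + b * (weightMoment P T s).toReal * |ξ| ^ s := by
  have hsum_eq : ∀ (r : ℝ) (ω : Ω), ∑ i, ENNReal.ofReal (T i ω ^ r) = ENNReal.ofReal (∑ i, T i ω ^ r) :=
    fun r ω => (ENNReal.ofReal_sum_of_nonneg fun i _ => Real.rpow_nonneg (hT.nonneg i ω) r).symm
  have hnn : ∀ r : ℝ, ∀ᵐ ω ∂P, 0 ≤ ∑ i, T i ω ^ r := fun r =>
    Filter.Eventually.of_forall fun ω =>
      Finset.sum_nonneg fun i _ => Real.rpow_nonneg (hT.nonneg i ω) r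
  have hmeas : ∀ r : ℝ, AEStronglyMeasurable (fun ω => ∑ i, T i ω ^ r) P := fun r =>
    (Finset.measurable_sum _ fun i _ => (hT.measurable i).pow_const r).aestronglyMeasurable
  have hint : ∀ r : ℝ, weightMoment P T r < ⊤ → Integrable (fun ω => ∑ i, T i ω ^ r) P := by
    intro r hr
    refine ⟨hmeas r, ?_⟩
    rw [hasFiniteIntegral_iff_ofReal (hnn r)]
    simpa only [weightMoment, hsum_eq] using hr
  have hval : ∀ r : ℝ, ∫ ω, ∑ i, T i ω ^ r ∂P = (weightMoment P T r).toReal := by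
    intro r
    rw [integral_eq_lintegral_of_nonneg_ae (hnn r) (hmeas r)]
    simp only [weightMoment, hsum_eq]
  have hbd : ∀ (κ : Measure ℝ) [IsProbabilityMeasure κ],
      Integrable (fun ω => ∏ i, charFun κ (ξ * T i ω)) P := by
    intro κ _
    have := hT.measurable
    refine Integrable.of_bound (C := 1) (Measurable.aestronglyMeasurable (by fun_prop))
      (Filter.Eventually.of_forall fun x => ?_)
    rw [norm_prod]
    exact Finset.prod_le_one (fun i _ => norm_nonneg _) fun i _ => norm_charFun_le_one _
  have h1 := hint 1 (by simp [hT.weightMoment_one])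
  rw [charFun_smoothing hT.measurable, charFun_smoothing hT.measurable,
    ← integral_sub (hbd μ) (hbd ν)]
  refine (norm_integral_le_integral_norm _).trans ?_
  calc _ ≤ ∫ ω, (a * |ξ| * ∑ i, T i ω ^ (1 : ℝ) + b * |ξ| ^ s * ∑ i, T i ω ^ s) ∂P := by
        refine integral_mono_of_nonneg (Filter.Eventually.of_forall fun ω => norm_nonneg _)
          ((h1.const_mul _).add ((hint s hs).const_mul _))
          (Filter.Eventually.of_forall fun ω => ?_)
        refine (norm_prod_sub_prod_le _ _ (fun i => norm_charFun_le_one _)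
          (fun i => norm_charFun_le_one _)).trans ?_
        beta_reduce
        rw [Finset.mul_sum, Finset.mul_sum, ← Finset.sum_add_distrib]
        refine Finset.sum_le_sum fun i _ => (h _).trans (le_of_eq ?_)
        rw [abs_mul, abs_of_nonneg (hT.nonneg i ω),
          Real.mul_rpow (abs_nonneg _) (hT.nonneg i ω), Real.rpow_one]
        ring
    _ = _ := by
        rw [integral_add (h1.const_mul _) ((hint s hs).const_mul _), integral_const_mul,
          integral_const_mul, hval, hval, hT.weightMoment_one]
        simp only [ENNReal.toReal_one]
        ring

/-- The Fourier estimates require an exponent at most 2. The weight moment is convex in the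
exponent, equals 1 at 1 and is below 1 at s, hence is below 1 at 2 if s ≥ 2. -/
lemma exists_weightMoment_lt_one_le_two (hT : IsNormalizedWeights P T) {s : ℝ} (hs : 1 < s)
    (h : weightMoment P T s < 1) : ∃ r, 1 < r ∧ r ≤ 2 ∧ weightMoment P T r < 1 := by
  rcases le_total s 2 with h2 | h2
  · exact ⟨s, hs, h2, h⟩
  refine ⟨2, by norm_num, le_rfl, ?_⟩
  set t : ℝ := 1 / (s - 1) with ht
  have hs1 : 0 < s - 1 := by linarith
  have ht0 : 0 < t := by positivity
  have ht1 : t ≤ 1 := by rw [ht, div_le_one hs1]; linarith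
  have htt : (1 - t) * 1 + t * s = 2 := by rw [ht]; field_simp; ring
  have hle : weightMoment P T 2 ≤ ENNReal.ofReal (1 - t) * weightMoment P T 1
      + ENNReal.ofReal t * weightMoment P T s := by
    have := hT.measurable
    unfold weightMoment
    rw [← lintegral_const_mul _ (by fun_prop), ← lintegral_const_mul _ (by fun_prop),
      ← lintegral_add_left (by fun_prop)]
    refine lintegral_mono fun ω => ?_
    rw [Finset.mul_sum, Finset.mul_sum, ← Finset.sum_add_distrib]
    refine Finset.sum_le_sum fun i _ => ?_
    rw [← ENNReal.ofReal_mul (by linarith), ← ENNReal.ofReal_mul ht0.le,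
      ← ENNReal.ofReal_add (mul_nonneg (by linarith) (Real.rpow_nonneg (hT.nonneg i ω) _))
        (mul_nonneg ht0.le (Real.rpow_nonneg (hT.nonneg i ω) _))]
    refine ENNReal.ofReal_le_ofReal ?_
    rcases (hT.nonneg i ω).eq_or_lt with h0 | h0
    · rw [← h0, Real.zero_rpow two_ne_zero, Real.zero_rpow one_ne_zero,
        Real.zero_rpow (by linarith)]
      simp
    · have h3 := rpow_convexComb_le (x := 1) (y := s) h0 ht0.le ht1
      rwa [htt] at h3
  refine hle.trans_lt ?_
  rw [hT.weightMoment_one]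
  have hfin : ENNReal.ofReal t * weightMoment P T s < ENNReal.ofReal t * 1 :=
    ENNReal.mul_lt_mul_right (by simpa using ht0) ENNReal.ofReal_ne_top h
  calc _ < ENNReal.ofReal (1 - t) * 1 + ENNReal.ofReal t * 1 :=
        ENNReal.add_lt_add_left (by simp) hfin
    _ = 1 := by
        rw [mul_one, mul_one, ← ENNReal.ofReal_add (by linarith) ht0.le]
        simp

/-- Uniqueness of the fixed point of the smoothing transform among laws with mean one. -/
theorem IsMeanOne.eq_of_smoothing_eq [IsProbabilityMeasure P] (hT : IsNormalizedWeights P T) {s : ℝ} (hs : 1 < s)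
    (h : weightMoment P T s < 1) {μ ν : Measure ℝ} (hμ : IsMeanOne μ) (hν : IsMeanOne ν)
    (hμfix : smoothing P T μ = μ) (hνfix : smoothing P T ν = ν) : μ = ν := by
  obtain ⟨r, hr1, hr2, hr⟩ := exists_weightMoment_lt_one_le_two hT hs h
  have := hμ.isProbabilityMeasure
  have := hν.isProbabilityMeasure
  have hrfin : weightMoment P T r < ⊤ := hr.trans ENNReal.one_lt_top
  set m := (weightMoment P T r).toReal with hm
  have hm0 : 0 ≤ m := ENNReal.toReal_nonneg
  have hm1 : m < 1 := by
    have := (ENNReal.toReal_lt_toReal hrfin.ne ENNReal.one_ne_top).2 hr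
    simpa using this
  refine Measure.ext_of_charFun (funext fun ξ => ?_)
  have hle : ∀ ε : ℝ, 0 < ε → ‖charFun μ ξ - charFun ν ξ‖ ≤ ε * |ξ| := by
    intro ε hε
    obtain ⟨C, hC0, hC⟩ := hμ.exists_norm_charFun_sub_le hr1.le hr2 (half_pos hε)
    obtain ⟨D, hD0, hD⟩ := hν.exists_norm_charFun_sub_le hr1.le hr2 (half_pos hε)
    -- With ε fixed, iteration keeps the linear coefficient ε and shrinks the other by m at each
    -- application. So n → ∞ is taken first and ε → 0 afterwards.
    have hiter : ∀ n : ℕ, ∀ ξ : ℝ,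
        ‖charFun μ ξ - charFun ν ξ‖ ≤ ε * |ξ| + (C + D) * m ^ n * |ξ| ^ r := by
      intro n
      induction n with
      | zero =>
        intro ξ
        have : charFun μ ξ - charFun ν ξ
          = (charFun μ ξ - 1 - ξ * Complex.I) - (charFun ν ξ - 1 - ξ * Complex.I) := by ring
        rw [this]
        refine (norm_sub_le _ _).trans ((add_le_add (hC ξ) (hD ξ)).trans (le_of_eq ?_))
        ring
      | succ n ih =>
        intro ξ
        have h2 := norm_charFun_sub_smoothing_le hT hrfin ih ξ
        rw [hμfix, hνfix] at h2
        refine h2.trans (le_of_eq ?_)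
        rw [← hm]; ring
    have hlim : Filter.Tendsto (fun n : ℕ => ε * |ξ| + (C + D) * m ^ n * |ξ| ^ r) Filter.atTop
        (nhds (ε * |ξ| + (C + D) * 0 * |ξ| ^ r)) :=
      (((tendsto_pow_atTop_nhds_zero_of_lt_one hm0 hm1).const_mul _).mul_const _).const_add _
    have := ge_of_tendsto' hlim fun n => hiter n ξ
    simpa using this
  have hzero : ‖charFun μ ξ - charFun ν ξ‖ ≤ 0 := by
    refine le_of_forall_pos_le_add fun δ hδ => ?_
    have h3 := hle (δ / (|ξ| + 1)) (by positivity)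
    refine h3.trans ?_
    rw [zero_add, div_mul_eq_mul_div, div_le_iff₀ (by positivity)]
    nlinarith [abs_nonneg ξ]
  exact sub_eq_zero.1 (norm_le_zero_iff.1 hzero)

end Transform

/-! ### Moments of order above one: bounds on the iterates and a necessary condition. -/

section MomentBounds

variable {Ω : Type*} [MeasurableSpace Ω] {ι : Type*} [Fintype ι] {P : Measure Ω} {T : ι → Ω → ℝ}
  {ζ : Measure ℝ}

lemma ae_pi_nonneg [IsProbabilityMeasure ζ] (h : ∀ᵐ z ∂ζ, 0 ≤ z) :
    ∀ᵐ z ∂(Measure.pi fun _ : ι => ζ), ∀ i, 0 ≤ z i := by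
  rw [ae_all_iff]
  exact fun i => (measurePreserving_eval (fun _ : ι => ζ) i).quasiMeasurePreserving.ae h

lemma lintegral_pi_eval [IsProbabilityMeasure ζ] (i : ι) {f : ℝ → ℝ≥0∞} (hf : Measurable f) :
    ∫⁻ z, f (z i) ∂(Measure.pi fun _ : ι => ζ) = ∫⁻ z, f z ∂ζ :=
  (measurePreserving_eval (fun _ : ι => ζ) i).lintegral_comp hf

lemma lintegral_pi_eval_mul_eval [IsProbabilityMeasure ζ] {i j : ι} (hij : i ≠ j)
    {f g : ℝ → ℝ≥0∞} (hf : Measurable f) (hg : Measurable g) :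
    ∫⁻ z, f (z i) * g (z j) ∂(Measure.pi fun _ : ι => ζ)
      = (∫⁻ z, f z ∂ζ) * ∫⁻ z, g z ∂ζ := by
  have hind : ProbabilityTheory.IndepFun (fun z : ι → ℝ => z i) (fun z => z j)
      (Measure.pi fun _ : ι => ζ) :=
    (ProbabilityTheory.iIndepFun_pi (X := fun (_ : ι) (z : ℝ) => z)
      (fun _ => aemeasurable_id)).indepFun hij
  have h := ProbabilityTheory.lintegral_mul_eq_lintegral_mul_lintegral_of_indepFun
    (hf.comp (measurable_pi_apply i)) (hg.comp (measurable_pi_apply j)) (hind.comp hf hg)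
  simp only [Pi.mul_apply, Function.comp_apply] at h
  rw [h, lintegral_pi_eval i hf, lintegral_pi_eval j hg]

lemma ae_nonneg_smoothing (hT : IsNormalizedWeights P T) [IsProbabilityMeasure P]
    [IsProbabilityMeasure ζ] (h : ∀ᵐ z ∂ζ, 0 ≤ z) : ∀ᵐ z ∂smoothing P T ζ, 0 ≤ z := by
  rw [smoothing, ae_map_iff (measurable_weightedSum hT.measurable).aemeasurable measurableSet_Ici]
  have h2 : ∀ᵐ x ∂(P.prod (Measure.pi fun _ : ι => ζ)), ∀ i, 0 ≤ x.2 i :=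
    Measure.quasiMeasurePreserving_snd.ae (ae_pi_nonneg h)
  filter_upwards [h2] with x hx
  exact Finset.sum_nonneg fun i _ => mul_nonneg (hT.nonneg i _) (hx i)

lemma lintegral_lintegral_sum_rpow (hT : IsNormalizedWeights P T) [IsProbabilityMeasure ζ]
    (h : ∀ᵐ z ∂ζ, 0 ≤ z) (s : ℝ) :
    ∫⁻ ω, ∫⁻ z, ENNReal.ofReal (∑ i, (T i ω * z i) ^ s) ∂(Measure.pi fun _ : ι => ζ) ∂P
      = weightMoment P T s * moment ζ s := by
  have hm := hT.measurable
  rw [weightMoment, ← lintegral_mul_const _ (by fun_prop)]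
  refine lintegral_congr fun ω => ?_
  have h1 : ∫⁻ z, ENNReal.ofReal (∑ i, (T i ω * z i) ^ s) ∂(Measure.pi fun _ : ι => ζ)
      = ∫⁻ z, ∑ i, ENNReal.ofReal (T i ω ^ s) * ENNReal.ofReal (z i ^ s)
          ∂(Measure.pi fun _ : ι => ζ) := by
    refine lintegral_congr_ae ?_
    filter_upwards [ae_pi_nonneg h] with z hz
    rw [ENNReal.ofReal_sum_of_nonneg fun i _ =>
      Real.rpow_nonneg (mul_nonneg (hT.nonneg i ω) (hz i)) s]
    refine Finset.sum_congr rfl fun i _ => ?_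
    rw [Real.mul_rpow (hT.nonneg i ω) (hz i),
      ENNReal.ofReal_mul (Real.rpow_nonneg (hT.nonneg i ω) s)]
  rw [h1, lintegral_finsetSum _ (by fun_prop), Finset.sum_mul]
  refine Finset.sum_congr rfl fun i _ => ?_
  rw [lintegral_const_mul _ (by fun_prop),
    lintegral_pi_eval i (f := fun z => ENNReal.ofReal (z ^ s)) (by fun_prop), moment]

lemma IsMeanOne.smoothing [IsProbabilityMeasure P] (hT : IsNormalizedWeights P T)
    (h : IsMeanOne ζ) : IsMeanOne (smoothing P T ζ) := by
  have := h.isProbabilityMeasure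
  refine ⟨isProbabilityMeasure_smoothing hT.measurable ζ, ae_nonneg_smoothing hT h.nonneg, ?_⟩
  have h1 := lintegral_lintegral_sum_rpow hT h.nonneg 1
  rw [h.mean, hT.weightMoment_one, one_mul] at h1
  rw [moment, lintegral_smoothing hT.measurable ζ (by fun_prop)]
  simpa using h1

lemma moment_sub_one_le [IsProbabilityMeasure ζ] (h : ∀ᵐ z ∂ζ, 0 ≤ z) {s : ℝ} (hs : 1 < s)
    {ε : ℝ} (hε : 0 < ε) :
    moment ζ (s - 1) ≤ ENNReal.ofReal ε * moment ζ s + ENNReal.ofReal ((ε⁻¹) ^ (s - 1)) := by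
  calc moment ζ (s - 1)
      ≤ ∫⁻ z, (ENNReal.ofReal ε * ENNReal.ofReal (z ^ s)
          + ENNReal.ofReal ((ε⁻¹) ^ (s - 1))) ∂ζ := by
        refine lintegral_mono_ae ?_
        filter_upwards [h] with z hz
        rw [← ENNReal.ofReal_mul hε.le, ← ENNReal.ofReal_add
          (mul_nonneg hε.le (Real.rpow_nonneg hz s)) (Real.rpow_nonneg (by positivity) _)]
        exact ENNReal.ofReal_le_ofReal (rpow_sub_one_le hs hε hz)
    _ = _ := by
        rw [lintegral_add_right _ measurable_const, lintegral_const_mul _ (by fun_prop)]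
        simp [moment]

/-- For i ≠ j, t_i^(s-1) t_j ≤ t_i^s + t_j^s ≤ ∑ t_k^s. The weights thus leave the cross terms as a
single factor whose mean is `weightMoment`. -/
lemma ofReal_rpow_weightedSum_le [DecidableEq ι] {s : ℝ} (hs : 1 < s) {t z : ι → ℝ}
    (ht : ∀ i, 0 ≤ t i) (hz : ∀ i, 0 ≤ z i) :
    ENNReal.ofReal ((∑ i, t i * z i) ^ s) ≤ ENNReal.ofReal (∑ i, (t i * z i) ^ s)
      + ENNReal.ofReal (s * (Fintype.card ι : ℝ) ^ (s - 1)) * (∑ k, ENNReal.ofReal (t k ^ s)) *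
        ∑ i, ∑ j ∈ Finset.univ.erase i, ENNReal.ofReal (z i ^ (s - 1)) * ENNReal.ofReal (z j) := by
  have hc : 0 ≤ s * (Fintype.card ι : ℝ) ^ (s - 1) := by
    have : 0 ≤ s := by linarith
    positivity
  have hzz : ∀ i j, 0 ≤ z i ^ (s - 1) * z j := fun i j =>
    mul_nonneg (Real.rpow_nonneg (hz i) _) (hz j)
  have hW : 0 ≤ ∑ k, t k ^ s := Finset.sum_nonneg fun k _ => Real.rpow_nonneg (ht k) s
  have hsum : ∑ i, ∑ j ∈ Finset.univ.erase i, ENNReal.ofReal (z i ^ (s - 1)) * ENNReal.ofReal (z j)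
      = ENNReal.ofReal (∑ i, ∑ j ∈ Finset.univ.erase i, z i ^ (s - 1) * z j) := by
    rw [ENNReal.ofReal_sum_of_nonneg fun i _ => Finset.sum_nonneg fun j _ => hzz i j]
    refine Finset.sum_congr rfl fun i _ => ?_
    rw [ENNReal.ofReal_sum_of_nonneg fun j _ => hzz i j]
    exact Finset.sum_congr rfl fun j _ =>
      (ENNReal.ofReal_mul (Real.rpow_nonneg (hz i) _)).symm
  rw [hsum, ← ENNReal.ofReal_sum_of_nonneg fun k _ => Real.rpow_nonneg (ht k) s,
    ← ENNReal.ofReal_mul hc, ← ENNReal.ofReal_mul (mul_nonneg hc hW),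
    ← ENNReal.ofReal_add (Finset.sum_nonneg fun i _ =>
      Real.rpow_nonneg (mul_nonneg (ht i) (hz i)) s) (mul_nonneg (mul_nonneg hc hW)
        (Finset.sum_nonneg fun i _ => Finset.sum_nonneg fun j _ => hzz i j))]
  refine ENNReal.ofReal_le_ofReal
    ((sum_rpow_le_sum_rpow_add_cross hs.le fun i => mul_nonneg (ht i) (hz i)).trans ?_)
  rw [mul_assoc _ (∑ k, t k ^ s)]
  refine add_le_add le_rfl (mul_le_mul_of_nonneg_left ?_ hc)
  rw [Finset.mul_sum]
  refine Finset.sum_le_sum fun i _ => ?_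
  rw [Finset.mul_sum]
  refine Finset.sum_le_sum fun j hj => ?_
  rw [Real.mul_rpow (ht i) (hz i)]
  have h1 : t i ^ (s - 1) * t j ≤ ∑ k, t k ^ s := by
    refine (rpow_sub_one_mul_le hs (ht i) (ht j)).trans ?_
    rw [← Finset.add_sum_erase _ _ (Finset.mem_univ i)]
    gcongr
    exact Finset.single_le_sum (f := fun k => t k ^ s) (fun k _ => Real.rpow_nonneg (ht k) s) hj
  calc _ = (t i ^ (s - 1) * t j) * (z i ^ (s - 1) * z j) := by ring
    _ ≤ _ := mul_le_mul_of_nonneg_right h1 (hzz i j)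

/-- Independence and mean one give E[Z_i^(s-1) Z_j] = E[Z^(s-1)] for i ≠ j, and there are at most
card² such pairs. -/
lemma moment_smoothing_le (hT : IsNormalizedWeights P T)
    (h : IsMeanOne ζ) {s : ℝ} (hs : 1 < s) :
    moment (smoothing P T ζ) s ≤ weightMoment P T s * moment ζ s
      + ENNReal.ofReal (s * (Fintype.card ι : ℝ) ^ (s - 1)) * (Fintype.card ι) ^ 2
        * weightMoment P T s * moment ζ (s - 1) := by
  classical
  have := h.isProbabilityMeasure
  have hm := hT.measurable
  set c := ENNReal.ofReal (s * (Fintype.card ι : ℝ) ^ (s - 1)) with hc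
  have hcross : ∫⁻ z, ∑ i, ∑ j ∈ Finset.univ.erase i,
      ENNReal.ofReal (z i ^ (s - 1)) * ENNReal.ofReal (z j) ∂(Measure.pi fun _ : ι => ζ)
      ≤ (Fintype.card ι) ^ 2 * moment ζ (s - 1) := by
    rw [lintegral_finsetSum _ (by fun_prop)]
    have hle : ∀ i : ι, ∫⁻ z, ∑ j ∈ Finset.univ.erase i,
        ENNReal.ofReal (z i ^ (s - 1)) * ENNReal.ofReal (z j) ∂(Measure.pi fun _ : ι => ζ)
        ≤ Fintype.card ι * moment ζ (s - 1) := by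
      intro i
      rw [lintegral_finsetSum _ (by fun_prop)]
      have heq : ∀ j ∈ Finset.univ.erase i, ∫⁻ z, ENNReal.ofReal (z i ^ (s - 1)) *
          ENNReal.ofReal (z j) ∂(Measure.pi fun _ : ι => ζ) = moment ζ (s - 1) := by
        intro j hj
        rw [lintegral_pi_eval_mul_eval (f := fun z => ENNReal.ofReal (z ^ (s - 1)))
          (g := fun z => ENNReal.ofReal z) (Finset.ne_of_mem_erase hj).symm (by fun_prop)
          (by fun_prop)]
        have h1 := h.mean
        simp only [moment, Real.rpow_one] at h1
        rw [h1, mul_one, moment]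
      rw [Finset.sum_congr rfl heq, Finset.sum_const, nsmul_eq_mul]
      gcongr
      exact_mod_cast Finset.card_le_univ _
    calc _ ≤ ∑ _i : ι, (Fintype.card ι : ℝ≥0∞) * moment ζ (s - 1) :=
          Finset.sum_le_sum fun i _ => hle i
      _ = _ := by
          rw [Finset.sum_const, nsmul_eq_mul, Finset.card_univ]; ring
  calc moment (smoothing P T ζ) s
      = ∫⁻ ω, ∫⁻ z, ENNReal.ofReal ((∑ i, T i ω * z i) ^ s) ∂(Measure.pi fun _ : ι => ζ) ∂P := by
        rw [moment, lintegral_smoothing hT.measurable ζ (by fun_prop)]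
    _ ≤ ∫⁻ ω, (∫⁻ z, ENNReal.ofReal (∑ i, (T i ω * z i) ^ s) ∂(Measure.pi fun _ : ι => ζ)
          + c * (∑ k, ENNReal.ofReal (T k ω ^ s)) * ((Fintype.card ι) ^ 2 * moment ζ (s - 1)))
          ∂P := by
        refine lintegral_mono fun ω => ?_
        calc _ ≤ ∫⁻ z, (ENNReal.ofReal (∑ i, (T i ω * z i) ^ s)
              + c * (∑ k, ENNReal.ofReal (T k ω ^ s)) * ∑ i, ∑ j ∈ Finset.univ.erase i,
                ENNReal.ofReal (z i ^ (s - 1)) * ENNReal.ofReal (z j))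
                ∂(Measure.pi fun _ : ι => ζ) := by
              refine lintegral_mono_ae ?_
              filter_upwards [ae_pi_nonneg h.nonneg] with z hz
              exact ofReal_rpow_weightedSum_le hs (fun i => hT.nonneg i ω) hz
          _ ≤ _ := by
              rw [lintegral_add_right _ (by fun_prop), lintegral_const_mul _ (by fun_prop)]
              gcongr
    _ = _ := by
        rw [lintegral_add_right _ (by fun_prop), lintegral_lintegral_sum_rpow hT h.nonneg,
          lintegral_mul_const _ (by fun_prop), lintegral_const_mul _ (by fun_prop)]
        simp only [weightMoment]
        ring

/-- The iterates of the smoothing transform, started from the point mass at one. -/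
noncomputable def iterates (P : Measure Ω) (T : ι → Ω → ℝ) : ℕ → Measure ℝ
  | 0 => Measure.dirac 1
  | n + 1 => smoothing P T (iterates P T n)

lemma isMeanOne_dirac_one : IsMeanOne (Measure.dirac 1) where
  isProbabilityMeasure := inferInstance
  nonneg := by rw [ae_dirac_iff measurableSet_Ici]; exact zero_le_one
  mean := by simp [moment]

lemma isMeanOne_iterates [IsProbabilityMeasure P] (hT : IsNormalizedWeights P T) (n : ℕ) :
    IsMeanOne (iterates P T n) := by
  induction n with
  | zero => exact isMeanOne_dirac_one
  | succ n ih => exact ih.smoothing hT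

lemma exists_moment_iterates_le [IsProbabilityMeasure P] (hT : IsNormalizedWeights P T) {s : ℝ}
    (hs : 1 < s) (h : weightMoment P T s < 1) :
    ∃ B : ℝ, ∀ n, moment (iterates P T n) s ≤ ENNReal.ofReal B := by
  have hfin : weightMoment P T s ≠ ⊤ := (h.trans ENNReal.one_lt_top).ne
  set m := (weightMoment P T s).toReal with hm
  have hm0 : 0 ≤ m := ENNReal.toReal_nonneg
  have hm1 : m < 1 := by
    simpa using (ENNReal.toReal_lt_toReal hfin ENNReal.one_ne_top).2 h
  have hmeq : weightMoment P T s = ENNReal.ofReal m := (ENNReal.ofReal_toReal hfin).symm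
  set c := s * (Fintype.card ι : ℝ) ^ (s - 1) * (Fintype.card ι : ℝ) ^ 2 * m with hc
  have hc' : 0 ≤ s * (Fintype.card ι : ℝ) ^ (s - 1) := by
    have : 0 ≤ s := by linarith
    positivity
  have hc0 : 0 ≤ c := by positivity
  have hceq : ENNReal.ofReal (s * (Fintype.card ι : ℝ) ^ (s - 1)) * (Fintype.card ι) ^ 2
      * weightMoment P T s = ENNReal.ofReal c := by
    rw [hc, hmeq, ENNReal.ofReal_mul (mul_nonneg hc' (by positivity)), ENNReal.ofReal_mul hc',
      ENNReal.ofReal_pow (by positivity), ENNReal.ofReal_natCast]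
  -- Chosen so that cε ≤ (1 - m)/2: absorbing the moment of order s - 1 leaves a recursion with
  -- factor at most (1 + m)/2 < 1. The 1 added to c excludes a zero denominator.
  set ε := (1 - m) / (2 * (c + 1)) with hε
  have hε0 : 0 < ε := div_pos (by linarith) (by positivity)
  have hcε : c * ε ≤ (1 - m) / 2 := by
    rw [hε, mul_div_assoc', div_le_div_iff₀ (by positivity) two_pos]
    nlinarith
  set D := c * (ε⁻¹) ^ (s - 1) with hD
  have hD0 : 0 ≤ D := by positivity
  -- The recursion preserves every bound B ≥ 2D/(1 - m); the 1 is the moment of the initial point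
  -- mass.
  set B := max 1 (2 * D / (1 - m)) with hB
  have hB1 : 1 ≤ B := le_max_left _ _
  have hBD : D ≤ (1 - m) / 2 * B := by
    have : 2 * D / (1 - m) ≤ B := le_max_right _ _
    rw [div_le_iff₀ (by linarith)] at this
    linarith
  refine ⟨B, fun n => ?_⟩
  induction n with
  | zero => simpa [iterates, moment] using hB1
  | succ n ih =>
    have hn := isMeanOne_iterates hT n
    have := hn.isProbabilityMeasure
    refine (moment_smoothing_le hT hn hs).trans ?_
    rw [hceq, hmeq]
    calc _ ≤ ENNReal.ofReal m * ENNReal.ofReal B + ENNReal.ofReal c *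
          (ENNReal.ofReal ε * ENNReal.ofReal B + ENNReal.ofReal ((ε⁻¹) ^ (s - 1))) := by
          gcongr
          refine (moment_sub_one_le hn.nonneg hs hε0).trans ?_
          gcongr
      _ = ENNReal.ofReal (m * B + c * (ε * B + (ε⁻¹) ^ (s - 1))) := by
          have : 0 ≤ (ε⁻¹) ^ (s - 1) := by positivity
          rw [ENNReal.ofReal_add (by positivity) (by positivity), ENNReal.ofReal_mul hm0,
            ENNReal.ofReal_mul hc0, ENNReal.ofReal_add (by positivity) this,
            ENNReal.ofReal_mul hε0.le]
      _ ≤ ENNReal.ofReal B := by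
          refine ENNReal.ofReal_le_ofReal ?_
          have h1 : c * ε * B ≤ (1 - m) / 2 * B := by gcongr
          have h2 : c * (ε * B + (ε⁻¹) ^ (s - 1)) = c * ε * B + D := by rw [hD]; ring
          rw [h2]
          linarith

/-- A finite moment of order `s > 1` of a fixed point forces `E [∑ i, T i ^ s] < 1`. -/
theorem weightMoment_lt_one_of_moment_lt_top [IsProbabilityMeasure P]
    (hT : IsNormalizedWeights P T)
    (htwo : ¬ ∀ᵐ ω ∂P, ∀ i j, 0 < T i ω → 0 < T j ω → i = j) (h : IsMeanOne ζ)
    (hfix : smoothing P T ζ = ζ) {s : ℝ} (hs : 1 < s) (hfin : moment ζ s < ⊤) :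
    weightMoment P T s < 1 := by
  have := h.isProbabilityMeasure
  have hm := measurable_weightedSum hT.measurable
  have hm' := hT.measurable
  have hne : ζ (Set.Ioi 0) ≠ 0 := by
    intro h0
    have : moment ζ 1 = 0 := by
      refine lintegral_eq_zero_of_ae_eq_zero ?_
      have h1 : ∀ᵐ z ∂ζ, z ∉ Set.Ioi (0 : ℝ) := measure_eq_zero_iff_ae_notMem.1 h0
      filter_upwards [h1] with z hz
      simpa using hz
    rw [h.mean] at this
    exact one_ne_zero this
  have hpos : moment ζ s ≠ 0 := by
    intro h0
    rw [moment, lintegral_eq_zero_iff (by fun_prop)] at h0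
    refine hne (measure_eq_zero_iff_ae_notMem.2 ?_)
    filter_upwards [h0] with z hz hz0
    exact absurd (ENNReal.ofReal_eq_zero.1 hz) (not_le.2 (Real.rpow_pos_of_pos hz0 s))
  set ρ := P.prod (Measure.pi fun _ : ι => ζ) with hρ
  have hnn : ∀ᵐ x ∂ρ, ∀ i, 0 ≤ x.2 i :=
    Measure.quasiMeasurePreserving_snd.ae (ae_pi_nonneg h.nonneg)
  -- `F ≤ G` by superadditivity of the power, and the fixed-point property gives `G` the integral
  -- `moment ζ s`. Comparing integrals yields `weightMoment P T s ≤ 1`.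
  set F : Ω × (ι → ℝ) → ℝ≥0∞ := fun x => ENNReal.ofReal (∑ i, (T i x.1 * x.2 i) ^ s) with hF
  set G : Ω × (ι → ℝ) → ℝ≥0∞ := fun x => ENNReal.ofReal ((∑ i, T i x.1 * x.2 i) ^ s) with hG
  have hFm : Measurable F := by fun_prop
  have hGm : Measurable G := by fun_prop
  have hFint : ∫⁻ x, F x ∂ρ = weightMoment P T s * moment ζ s := by
    rw [hρ, lintegral_prod _ hFm.aemeasurable, lintegral_lintegral_sum_rpow hT h.nonneg]
  have hGint : ∫⁻ x, G x ∂ρ = moment ζ s := by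
    conv_rhs => rw [← hfix]
    rw [moment, smoothing, lintegral_map (by fun_prop) hm]
  have hFG : F ≤ᵐ[ρ] G := by
    filter_upwards [hnn] with x hx
    exact ENNReal.ofReal_le_ofReal
      (sum_rpow_le_rpow_sum hs fun i => mul_nonneg (hT.nonneg i _) (hx i))
  have hle : weightMoment P T s * moment ζ s ≤ 1 * moment ζ s := by
    rw [← hFint, one_mul]
    exact (lintegral_mono_ae hFG).trans hGint.le
  have hle1 : weightMoment P T s ≤ 1 := (ENNReal.mul_le_mul_iff_left hpos hfin.ne).1 hle
  refine lt_of_le_of_ne hle1 fun heq => htwo ?_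
  -- If the weight moment were 1, the finite integrals would agree. Equality almost everywhere then
  -- contradicts strict superadditivity wherever two weights and all z_i are positive.
  have hae : F =ᵐ[ρ] G := by
    refine ae_eq_of_ae_le_of_lintegral_le hFG ?_ hGm.aemeasurable ?_
    · rw [hFint, heq, one_mul]; exact hfin.ne
    · rw [hGint, hFint, heq, one_mul]
  have hae2 : ∀ᵐ ω ∂P, ∀ᵐ z ∂(Measure.pi fun _ : ι => ζ), F (ω, z) = G (ω, z) :=
    Measure.ae_ae_of_ae_prod hae
  filter_upwards [hae2] with ω hω i j hi hj
  by_contra hij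
  have hU : (Measure.pi fun _ : ι => ζ) (Set.pi Set.univ fun _ => Set.Ioi (0 : ℝ)) ≠ 0 := by
    rw [Measure.pi_pi, Finset.prod_const]
    exact pow_ne_zero _ hne
  obtain ⟨z, hz, hz2⟩ : ∃ z, z ∈ (Set.pi Set.univ fun _ : ι => Set.Ioi (0 : ℝ))
      ∧ F (ω, z) = G (ω, z) := by
    by_contra hcon
    push Not at hcon
    refine hU (measure_eq_zero_iff_ae_notMem.2 ?_)
    filter_upwards [hω] with z hz hzU
    exact hcon z hzU hz
  have hz0 : ∀ k, 0 < z k := fun k => hz k (Set.mem_univ k)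
  have hlt := sum_rpow_lt_rpow_sum hs (x := fun k => T k ω * z k)
    (fun k => mul_nonneg (hT.nonneg k ω) (hz0 k).le) hij (mul_pos hi (hz0 i)) (mul_pos hj (hz0 j))
  have hGF : F (ω, z) < G (ω, z) := by
    refine (ENNReal.ofReal_lt_ofReal_iff_of_nonneg ?_).2 hlt
    exact Finset.sum_nonneg fun k _ =>
      Real.rpow_nonneg (mul_nonneg (hT.nonneg k ω) (hz0 k).le) s
  exact hGF.ne hz2

end MomentBounds

/-! ### Weak limits through characteristic functions. -/

open Filter Topology

/-- Lévy's continuity theorem: continuity at 0 gives tightness, Prokhorov's theorem gives a cluster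
point, and pointwise convergence identifies its characteristic function with f. -/
lemma exists_probabilityMeasure_tendsto_of_charFun {μ : ℕ → ProbabilityMeasure ℝ} {f : ℝ → ℂ}
    (hf : ContinuousAt f 0)
    (h : ∀ t, Tendsto (fun n => charFun (μ n : Measure ℝ) t) atTop (𝓝 (f t))) :
    ∃ ν : ProbabilityMeasure ℝ, Tendsto μ atTop (𝓝 ν) ∧
      ∀ t, charFun (ν : Measure ℝ) t = f t := by
  have htight : IsTightMeasureSet
      {((κ : ProbabilityMeasure ℝ) : Measure ℝ) | κ ∈ Set.range μ} := by
    convert! isTightMeasureSet_of_tendsto_charFun (μ := fun n => (μ n : Measure ℝ)) hf h using 1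
    ext κ
    simp
  obtain ⟨ν, -, hν⟩ := (isCompact_closure_of_isTightMeasureSet htight).exists_mapClusterPt
    (f := atTop) (u := μ) (by
      rw [le_principal_iff]
      exact mem_map.2 (univ_mem' fun n => subset_closure (Set.mem_range_self n)))
  have hchar : ∀ t, charFun (ν : Measure ℝ) t = f t := by
    intro t
    have hcont : Continuous fun κ : ProbabilityMeasure ℝ => charFun (κ : Measure ℝ) t := by
      rw [continuous_iff_continuousAt]
      intro κ
      have h2 := (ProbabilityMeasure.tendsto_iff_forall_integral_rclike_tendsto ℂ
        (μs := fun κ : ProbabilityMeasure ℝ => κ)).1 (tendsto_id (x := 𝓝 κ))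
        (BoundedContinuousFunction.innerProbChar t)
      simpa only [ContinuousAt, charFun_eq_integral_innerProbChar] using h2
    have h3 : MapClusterPt (charFun (ν : Measure ℝ) t) atTop
        (fun n => charFun (μ n : Measure ℝ) t) := hν.continuousAt_comp hcont.continuousAt
    exact eq_of_nhds_neBot (h3.clusterPt.mono (h t))
  exact ⟨ν, ProbabilityMeasure.tendsto_of_tendsto_charFun fun t => by rw [hchar t]; exact h t,
    hchar⟩

lemma ae_nonneg_of_tendsto {μ : ℕ → ProbabilityMeasure ℝ} {ν : ProbabilityMeasure ℝ}
    (h : Tendsto μ atTop (𝓝 ν)) (h0 : ∀ n, ∀ᵐ z ∂(μ n : Measure ℝ), 0 ≤ z) :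
    ∀ᵐ z ∂(ν : Measure ℝ), 0 ≤ z := by
  have h1 := ProbabilityMeasure.le_liminf_measure_open_of_tendsto h (isOpen_Iio (a := (0 : ℝ)))
  have h2 : ∀ n, (μ n : Measure ℝ) (Set.Iio 0) = 0 := fun n => by
    rw [measure_eq_zero_iff_ae_notMem]
    filter_upwards [h0 n] with z hz using by simpa using hz
  simp only [h2, liminf_const, nonpos_iff_eq_zero] at h1
  filter_upwards [measure_eq_zero_iff_ae_notMem.1 h1] with z hz using by simpa using hz

lemma moment_le_of_tendsto {μ : ℕ → ProbabilityMeasure ℝ} {ν : ProbabilityMeasure ℝ}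
    (h : Tendsto μ atTop (𝓝 ν)) (h0 : ∀ n, ∀ᵐ z ∂(μ n : Measure ℝ), 0 ≤ z) {s : ℝ} (hs : 0 ≤ s)
    {B : ℝ≥0∞} (hB : ∀ n, moment (μ n : Measure ℝ) s ≤ B) : moment (ν : Measure ℝ) s ≤ B := by
  -- The positive part makes the integrand continuous and non-negative on the whole line, as lower
  -- semicontinuity under weak limits requires.
  have hmax : ∀ κ : Measure ℝ, (∀ᵐ z ∂κ, 0 ≤ z) →
      moment κ s = ∫⁻ z, ENNReal.ofReal (max z 0 ^ s) ∂κ := fun κ hκ => by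
    refine lintegral_congr_ae ?_
    filter_upwards [hκ] with z hz using by rw [max_eq_left hz]
  rw [hmax _ (ae_nonneg_of_tendsto h h0)]
  refine (lintegral_le_liminf_lintegral_of_forall_isOpen_measure_le_liminf_measure
    (μs := fun n => (μ n : Measure ℝ)) (f := fun z => max z 0 ^ s)
    ((continuous_id.max continuous_const).rpow_const fun _ => Or.inr hs)
    (fun z => Real.rpow_nonneg (le_max_right _ _) _)
    fun G hG => ProbabilityMeasure.le_liminf_measure_open_of_tendsto h hG).trans ?_
  refine liminf_le_of_le (by isBoundedDefault) fun b hb => ?_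
  obtain ⟨n, hn⟩ := hb.exists
  exact hn.trans ((hmax _ (h0 n)).symm.le.trans (hB n))

/-! ### Existence of the fixed point. -/

section Existence

variable {Ω : Type*} [MeasurableSpace Ω] {ι : Type*} [Fintype ι] {P : Measure Ω}
  [IsProbabilityMeasure P] {T : ι → Ω → ℝ}

lemma tendsto_charFun_smoothing (hT : IsNormalizedWeights P T) {μ : ℕ → Measure ℝ} {ν : Measure ℝ}
    [∀ n, IsProbabilityMeasure (μ n)] [IsProbabilityMeasure ν]
    (h : ∀ t, Tendsto (fun n => charFun (μ n) t) atTop (𝓝 (charFun ν t))) (ξ : ℝ) :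
    Tendsto (fun n => charFun (smoothing P T (μ n)) ξ) atTop
      (𝓝 (charFun (smoothing P T ν) ξ)) := by
  have hm := hT.measurable
  simp only [charFun_smoothing hm]
  refine tendsto_integral_of_dominated_convergence (fun _ => 1)
    (fun n => Measurable.aestronglyMeasurable (by fun_prop)) (integrable_const _)
    (fun n => Eventually.of_forall fun ω => ?_)
    (Eventually.of_forall fun ω => tendsto_finsetProd _ fun i _ => h _)
  rw [norm_prod]
  exact Finset.prod_le_one (fun i _ => norm_nonneg _) fun i _ => norm_charFun_le_one _

/-- Divide by ξ and let ξ → 0+. This identifies the mean of the limit law by comparing two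
first-order expansions. -/
lemma eq_of_forall_abs_mul_le {x C r : ℝ} (hr : 1 < r)
    (h : ∀ ξ : ℝ, 0 < ξ → ξ * |x| ≤ C * ξ ^ r) : x = 0 := by
  have hlim : Tendsto (fun ξ : ℝ => C * ξ ^ (r - 1)) (𝓝[>] 0) (𝓝 (C * 0)) := by
    refine Tendsto.const_mul _ (tendsto_nhdsWithin_of_tendsto_nhds ?_)
    have := (Real.continuousAt_rpow_const 0 (r - 1) (Or.inr (by linarith))).tendsto
    rwa [Real.zero_rpow (by linarith)] at this
  have hle : |x| ≤ C * 0 := by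
    refine ge_of_tendsto hlim ?_
    filter_upwards [self_mem_nhdsWithin] with ξ hξ
    have hξ' : 0 < ξ := hξ
    have h1 := h ξ hξ'
    rw [rpow_eq_mul_rpow_sub_one hr hξ'.le] at h1
    refine le_of_mul_le_mul_left (h1.trans_eq ?_) hξ'
    ring
  simpa using hle

/-- Existence of a fixed point of the smoothing transform with mean one. Its moment of order
`p > 1` is finite as soon as `E [∑ i, T i ^ p] < 1`. -/
theorem exists_isMeanOne_smoothing_eq (hT : IsNormalizedWeights P T) {s : ℝ} (hs : 1 < s)
    (h : weightMoment P T s < 1) :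
    ∃ ζ : Measure ℝ, IsMeanOne ζ ∧ smoothing P T ζ = ζ ∧
      ∀ p : ℝ, 1 < p → weightMoment P T p < 1 → moment ζ p < ⊤ := by
  obtain ⟨r, hr1, hr2, hr⟩ := exists_weightMoment_lt_one_le_two hT hs h
  have hrfin : weightMoment P T r < ⊤ := hr.trans ENNReal.one_lt_top
  set m := (weightMoment P T r).toReal with hm
  have hm0 : 0 ≤ m := ENNReal.toReal_nonneg
  have hm1 : m < 1 := by
    simpa using (ENNReal.toReal_lt_toReal hrfin.ne ENNReal.one_ne_top).2 hr
  obtain ⟨B, hB⟩ := exists_moment_iterates_le hT hr1 hr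
  have hone := isMeanOne_iterates hT
  have hprob : ∀ n, IsProbabilityMeasure (iterates P T n) := fun n =>
    (hone n).isProbabilityMeasure
  have hB0 : 0 ≤ max B 0 := le_max_right _ _
  have hBr : ∀ n, (moment (iterates P T n) r).toReal ≤ max B 0 := fun n =>
    ENNReal.toReal_le_of_le_ofReal hB0
      ((hB n).trans (ENNReal.ofReal_le_ofReal (le_max_left _ _)))
  have hfinr : ∀ n, moment (iterates P T n) r < ⊤ := fun n =>
    (hB n).trans_lt ENNReal.ofReal_lt_top
  -- The r-th moments are bounded uniformly in n, so this expansion is uniform too and passes to the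
  -- limit `f`.
  have hexp : ∀ n ξ, ‖charFun (iterates P T n) ξ - 1 - ξ * Complex.I‖
      ≤ 2 * max B 0 * |ξ| ^ r := by
    intro n ξ
    have h1 := norm_charFun_sub_le_rpow hr1.le hr2 (hone n).nonneg (hfinr n) ξ
    rw [(hone n).mean] at h1
    simp only [ENNReal.toReal_one, Complex.ofReal_one, mul_one] at h1
    refine h1.trans ?_
    gcongr
    exact hBr n
  have hdiff : ∀ n ξ, ‖charFun (iterates P T n) ξ - charFun (iterates P T (n + 1)) ξ‖
      ≤ 0 * |ξ| + 4 * max B 0 * m ^ n * |ξ| ^ r := by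
    intro n
    induction n with
    | zero =>
      intro ξ
      have : charFun (iterates P T 0) ξ - charFun (iterates P T (0 + 1)) ξ
          = (charFun (iterates P T 0) ξ - 1 - ξ * Complex.I)
            - (charFun (iterates P T (0 + 1)) ξ - 1 - ξ * Complex.I) := by ring
      rw [this]
      refine (norm_sub_le _ _).trans
        ((add_le_add (hexp 0 ξ) (hexp (0 + 1) ξ)).trans (le_of_eq ?_))
      ring
    | succ n ih =>
      intro ξ
      refine (norm_charFun_sub_smoothing_le hT hrfin ih ξ).trans (le_of_eq ?_)
      rw [← hm]; ring
  have hcauchy : ∀ ξ, CauchySeq fun n => charFun (iterates P T n) ξ := by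
    intro ξ
    refine cauchySeq_of_le_geometric m (4 * max B 0 * |ξ| ^ r) hm1 fun n => ?_
    rw [dist_eq_norm]
    refine (hdiff n ξ).trans (le_of_eq ?_)
    ring
  choose f hf using fun ξ => cauchySeq_tendsto_of_complete (hcauchy ξ)
  have hfexp : ∀ ξ : ℝ, ‖f ξ - 1 - ξ * Complex.I‖ ≤ 2 * max B 0 * |ξ| ^ r := fun ξ =>
    le_of_tendsto' (((hf ξ).sub_const _).sub_const _).norm fun n => hexp n ξ
  have hf0 : f 0 = 1 := by
    have := hfexp 0
    rw [abs_zero, Real.zero_rpow (by linarith), mul_zero] at this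
    simpa [sub_eq_zero] using this
  have hfcont : ContinuousAt f 0 := by
    have hrhs : Tendsto (fun ξ : ℝ => 2 * max B 0 * |ξ| ^ r) (𝓝 0) (𝓝 0) := by
      have hc : Continuous fun ξ : ℝ => 2 * max B 0 * |ξ| ^ r :=
        continuous_const.mul (continuous_abs.rpow_const fun _ => Or.inr (by linarith))
      have := hc.tendsto 0
      simpa [Real.zero_rpow (by linarith : r ≠ 0)] using this
    have h1 : Tendsto (fun ξ : ℝ => f ξ - 1 - ξ * Complex.I) (𝓝 0) (𝓝 0) :=
      squeeze_zero_norm hfexp hrhs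
    have h2 : Tendsto (fun ξ : ℝ => (1 : ℂ) + ξ * Complex.I) (𝓝 0) (𝓝 1) := by
      have hc : Continuous fun ξ : ℝ => (1 : ℂ) + ξ * Complex.I := by fun_prop
      simpa using hc.tendsto 0
    have h3 := h1.add h2
    rw [ContinuousAt, hf0]
    simpa using h3
  obtain ⟨ν, hν, hνf⟩ := exists_probabilityMeasure_tendsto_of_charFun
    (μ := fun n => ⟨iterates P T n, hprob n⟩) hfcont hf
  have hνnn := ae_nonneg_of_tendsto hν fun n => (hone n).nonneg
  have hmom : ∀ p : ℝ, 1 < p → weightMoment P T p < 1 → moment (ν : Measure ℝ) p < ⊤ := by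
    intro p hp hwp
    obtain ⟨C, hC⟩ := exists_moment_iterates_le hT hp hwp
    exact (moment_le_of_tendsto hν (fun n => (hone n).nonneg) (by linarith) hC).trans_lt
      ENNReal.ofReal_lt_top
  have hνr := hmom r hr1 hr
  have hν1 := moment_one_lt_top hr1.le hνnn hνr
  -- Weak convergence alone could lose mass of the mean. Here `f` has slope i at 0 as a limit of the
  -- iterates, and slope i times the mean of ν as its characteristic function.
  have hmean : moment (ν : Measure ℝ) 1 = 1 := by
    have hx : (moment (ν : Measure ℝ) 1).toReal - 1 = 0 := by
      refine eq_of_forall_abs_mul_le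
        (C := 2 * max B 0 + 2 * (moment (ν : Measure ℝ) r).toReal) hr1 fun ξ hξ => ?_
      have h1 := norm_charFun_sub_le_rpow hr1.le hr2 hνnn hνr ξ
      have h2 := hfexp ξ
      rw [hνf] at h1
      set M := (moment (ν : Measure ℝ) 1).toReal
      have h3 : (f ξ - 1 - ξ * Complex.I) - (f ξ - 1 - ξ * M * Complex.I)
          = ((ξ * (M - 1) : ℝ) : ℂ) * Complex.I := by
        push_cast; ring
      have h4 := (norm_sub_le (f ξ - 1 - ξ * Complex.I) (f ξ - 1 - ξ * M * Complex.I)).trans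
        (add_le_add h2 h1)
      rw [h3, norm_mul, Complex.norm_I, mul_one, Complex.norm_real, Real.norm_eq_abs, abs_mul,
        abs_of_pos hξ] at h4
      linarith
    have h5 : (moment (ν : Measure ℝ) 1).toReal = 1 := by linarith
    rw [← ENNReal.ofReal_toReal hν1.ne, h5, ENNReal.ofReal_one]
  refine ⟨ν, ⟨inferInstance, hνnn, hmean⟩, ?_, hmom⟩
  have := isProbabilityMeasure_smoothing (P := P) hT.measurable (ν : Measure ℝ)
  refine Measure.ext_of_charFun (funext fun ξ => ?_)
  have h1 := tendsto_charFun_smoothing hT (μ := iterates P T) (ν := (ν : Measure ℝ))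
    (fun t => by rw [hνf t]; exact hf t) ξ
  have h2 : Tendsto (fun n => charFun (iterates P T (n + 1)) ξ) atTop
      (𝓝 (charFun (ν : Measure ℝ) ξ)) := by
    rw [hνf ξ]
    exact (tendsto_add_atTop_iff_nat 1).2 (hf ξ)
  exact tendsto_nhds_unique h1 h2

end Existence

end SmoothingTransform

namespace KacLike

/-! ### Convexity of the spectral data and the other root. -/

section Spectral

variable {Ω : Type*} [MeasurableSpace Ω] {N : ℕ} {P : Measure Ω} {A : Fin N → Ω → ℝ}

lemma measurable_momentSum_summand (hA : StandingAssumptions P A) (s : ℝ) :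
    Measurable fun ω => ∑ j, (if 0 < A j ω then ENNReal.ofReal (A j ω ^ s) else 0) := by
  have := hA.measurable
  refine Finset.measurable_sum _ fun j _ => Measurable.ite ?_ (by fun_prop) measurable_const
  exact measurableSet_lt measurable_const (hA.measurable j)

lemma ite_ofReal_rpow_eq (hA : StandingAssumptions P A) {s : ℝ} (hs : s ≠ 0) (j : Fin N) (ω : Ω) :
    (if 0 < A j ω then ENNReal.ofReal (A j ω ^ s) else 0) = ENNReal.ofReal (A j ω ^ s) := by
  split_ifs with h
  · rfl
  · rw [le_antisymm (not_lt.1 h) (hA.nonneg j ω), Real.zero_rpow hs, ENNReal.ofReal_zero]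

lemma momentSum_eq (hA : StandingAssumptions P A) {s : ℝ} (hs : s ≠ 0) :
    momentSum P A s = ∫⁻ ω, ∑ j, ENNReal.ofReal (A j ω ^ s) ∂P :=
  lintegral_congr fun ω => Finset.sum_congr rfl fun j _ => ite_ofReal_rpow_eq hA hs j ω

lemma momentSum_eq_ofReal (hA : StandingAssumptions P A) {s : ℝ} (hs : s ≠ 0) :
    momentSum P A s = ∫⁻ ω, ENNReal.ofReal (∑ j, A j ω ^ s) ∂P := by
  rw [momentSum_eq hA hs]
  exact lintegral_congr fun ω =>
    (ENNReal.ofReal_sum_of_nonneg fun i _ => Real.rpow_nonneg (hA.nonneg i ω) s).symm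

lemma integrable_sum_rpow (hA : StandingAssumptions P A) {s : ℝ} (hs : s ≠ 0)
    (h : momentSum P A s < ⊤) : Integrable (fun ω => ∑ j, A j ω ^ s) P := by
  have hm := hA.measurable
  refine ⟨Measurable.aestronglyMeasurable (by fun_prop), ?_⟩
  rw [hasFiniteIntegral_iff_ofReal (Filter.Eventually.of_forall fun ω =>
    Finset.sum_nonneg fun i _ => Real.rpow_nonneg (hA.nonneg i ω) s)]
  rwa [momentSum_eq_ofReal hA hs] at h

lemma toReal_momentSum (hA : StandingAssumptions P A) {s : ℝ} (hs : s ≠ 0) :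
    (momentSum P A s).toReal = ∫ ω, ∑ j, A j ω ^ s ∂P := by
  have hm := hA.measurable
  rw [momentSum_eq_ofReal hA hs, integral_eq_lintegral_of_nonneg_ae]
  · exact Filter.Eventually.of_forall fun ω =>
      Finset.sum_nonneg fun i _ => Real.rpow_nonneg (hA.nonneg i ω) s
  · exact Measurable.aestronglyMeasurable (by fun_prop)

lemma measure_eq_one_of_ae [IsProbabilityMeasure P] {p : Ω → Prop} (h : ∀ᵐ ω ∂P, p ω) :
    P {ω | p ω} = 1 := by
  rw [measure_congr (Filter.eventuallyEq_univ.2 h), measure_univ]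

lemma momentSum_ne_zero [IsProbabilityMeasure P] (hA : StandingAssumptions P A) {s : ℝ}
    (hs : s ≠ 0) : momentSum P A s ≠ 0 := by
  intro h0
  have hm := hA.measurable
  rw [momentSum_eq hA hs, lintegral_eq_zero_iff (by fun_prop)] at h0
  refine hA.count_not_trivial.ne (measure_eq_one_of_ae ?_)
  filter_upwards [h0] with ω hω
  left
  rw [posCount, Finset.sum_eq_zero_iff]
  intro i _
  have h1 : ENNReal.ofReal (A i ω ^ s) = 0 := (Finset.sum_eq_zero_iff.1 hω) i (Finset.mem_univ i)
  rw [if_neg]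
  intro hpos
  exact absurd (ENNReal.ofReal_eq_zero.1 h1) (not_le.2 (Real.rpow_pos_of_pos hpos s))

lemma momentSum_convexComb_le (hA : StandingAssumptions P A) {x y t : ℝ} (ht0 : 0 ≤ t)
    (ht1 : t ≤ 1) :
    momentSum P A ((1 - t) * x + t * y)
      ≤ ENNReal.ofReal (1 - t) * momentSum P A x + ENNReal.ofReal t * momentSum P A y := by
  unfold momentSum
  rw [← lintegral_const_mul _ (measurable_momentSum_summand hA x),
    ← lintegral_const_mul _ (measurable_momentSum_summand hA y),
    ← lintegral_add_left ((measurable_momentSum_summand hA x).const_mul _)]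
  refine lintegral_mono fun ω => ?_
  rw [Finset.mul_sum, Finset.mul_sum, ← Finset.sum_add_distrib]
  refine Finset.sum_le_sum fun j _ => ?_
  split_ifs with hj
  · rw [← ENNReal.ofReal_mul (by linarith), ← ENNReal.ofReal_mul ht0, ← ENNReal.ofReal_add
      (mul_nonneg (by linarith) (Real.rpow_nonneg hj.le _))
      (mul_nonneg ht0 (Real.rpow_nonneg hj.le _))]
    exact ENNReal.ofReal_le_ofReal (SmoothingTransform.rpow_convexComb_le hj ht0 ht1)
  · simp

lemma convexOn_toReal_momentSum (hA : StandingAssumptions P A) :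
    ConvexOn ℝ {s | momentSum P A s < ⊤} fun s => (momentSum P A s).toReal := by
  have key : ∀ x y a b : ℝ, momentSum P A x < ⊤ → momentSum P A y < ⊤ → 0 ≤ a → 0 ≤ b →
      a + b = 1 → ENNReal.ofReal a * momentSum P A x + ENNReal.ofReal b * momentSum P A y < ⊤ ∧
      momentSum P A (a * x + b * y)
        ≤ ENNReal.ofReal a * momentSum P A x + ENNReal.ofReal b * momentSum P A y := by
    intro x y a b hx hy ha hb hab
    refine ⟨ENNReal.add_lt_top.2 ⟨ENNReal.mul_lt_top ENNReal.ofReal_lt_top hx,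
      ENNReal.mul_lt_top ENNReal.ofReal_lt_top hy⟩, ?_⟩
    have := momentSum_convexComb_le hA (x := x) (y := y) hb (by linarith)
    rwa [show 1 - b = a by linarith] at this
  refine ⟨fun x hx y hy a b ha hb hab => ?_, fun x hx y hy a b ha hb hab => ?_⟩
  · obtain ⟨h1, h2⟩ := key x y a b hx hy ha hb hab
    exact h2.trans_lt h1
  · obtain ⟨h1, h2⟩ := key x y a b hx hy ha hb hab
    have h3 := ENNReal.toReal_mono h1.ne h2
    rw [ENNReal.toReal_add (ENNReal.mul_ne_top ENNReal.ofReal_ne_top hx.ne)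
      (ENNReal.mul_ne_top ENNReal.ofReal_ne_top hy.ne), ENNReal.toReal_mul, ENNReal.toReal_mul,
      ENNReal.toReal_ofReal ha, ENNReal.toReal_ofReal hb] at h3
    exact h3

lemma Q_eq_coe {s : ℝ} (h : momentSum P A s < ⊤) :
    Q P A s = (((momentSum P A s).toReal - 1 : ℝ) : EReal) := by
  rw [Q, ← EReal.coe_ennreal_toReal h.ne]
  norm_cast

lemma spectral_eq_coe {s : ℝ} (h : momentSum P A s < ⊤) :
    spectral P A s = ((((momentSum P A s).toReal - 1) / s : ℝ) : EReal) := by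
  rw [spectral, Q_eq_coe h, EReal.coe_div]

lemma spectral_lt_top_iff {s : ℝ} (hs : 0 < s) :
    spectral P A s < ⊤ ↔ momentSum P A s < ⊤ := by
  refine ⟨fun h => ?_, fun h => by rw [spectral_eq_coe h]; exact EReal.coe_lt_top _⟩
  by_contra hcon
  rw [not_lt, top_le_iff] at hcon
  rw [spectral, Q, hcon, show ((⊤ : ℝ≥0∞) : EReal) - 1 = ⊤ from rfl,
    EReal.top_div_of_pos_ne_top (by exact_mod_cast hs) (EReal.coe_ne_top s)] at h
  exact lt_irrefl _ h

/-- The convex function `Q s - s * μ γ`, whose sign is the sign of `μ s - μ γ`. -/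
noncomputable def gap (P : Measure Ω) (A : Fin N → Ω → ℝ) (γ s : ℝ) : ℝ :=
  (momentSum P A s).toReal - 1 - s * (((momentSum P A γ).toReal - 1) / γ)

lemma convexOn_gap (hA : StandingAssumptions P A) (γ : ℝ) :
    ConvexOn ℝ {s | momentSum P A s < ⊤} (gap P A γ) := by
  have h := convexOn_toReal_momentSum hA
  refine ⟨h.1, fun x hx y hy a b ha hb hab => ?_⟩
  have h1 := h.2 hx hy ha hb hab
  simp only [gap, smul_eq_mul] at h1 ⊢
  have h2 : a = 1 - b := by linarith
  subst h2
  linarith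

lemma gap_self {γ : ℝ} (hγ : γ ≠ 0) : gap P A γ γ = 0 := by
  rw [gap]; field_simp; ring

lemma spectral_lt_iff {γ s : ℝ} (hs : 0 < s) (hγ : momentSum P A γ < ⊤) :
    spectral P A s < spectral P A γ ↔ momentSum P A s < ⊤ ∧ gap P A γ s < 0 := by
  constructor
  · intro h
    have hfin := (spectral_lt_top_iff hs).1 (h.trans_le le_top)
    refine ⟨hfin, ?_⟩
    rw [spectral_eq_coe hfin, spectral_eq_coe hγ, EReal.coe_lt_coe_iff, div_lt_iff₀ hs] at h
    rw [gap]; linarith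
  · rintro ⟨hfin, h⟩
    rw [spectral_eq_coe hfin, spectral_eq_coe hγ, EReal.coe_lt_coe_iff, div_lt_iff₀ hs]
    rw [gap] at h; linarith

lemma spectral_eq_iff {γ s : ℝ} (hγ0 : 0 < γ) (hs : 0 < s) (hγ : momentSum P A γ < ⊤) :
    spectral P A s = spectral P A γ ↔ momentSum P A s < ⊤ ∧ gap P A γ s = 0 := by
  constructor
  · intro h
    have hfin := (spectral_lt_top_iff hs).1 (h.trans_lt ((spectral_lt_top_iff hγ0).2 hγ))
    refine ⟨hfin, ?_⟩
    rw [spectral_eq_coe hfin, spectral_eq_coe hγ, EReal.coe_eq_coe_iff, div_eq_iff hs.ne'] at h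
    rw [gap]; linarith
  · rintro ⟨hfin, h⟩
    rw [spectral_eq_coe hfin, spectral_eq_coe hγ, EReal.coe_eq_coe_iff, div_eq_iff hs.ne']
    rw [gap] at h; linarith

lemma _root_.ConvexOn.neg_of_lt_of_lt {D : Set ℝ} {f : ℝ → ℝ} (hf : ConvexOn ℝ D f) {a b c : ℝ}
    (ha : a ∈ D) (hc : c ∈ D) (hab : a < b) (hbc : b < c) (hfa : f a ≤ 0) (hfc : f c ≤ 0)
    (hneg : f a < 0 ∨ f c < 0) : f b < 0 := by
  have h := hf.secant_mono_aux1 ha hc hab hbc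
  have h1 : 0 < c - b := by linarith
  have h2 : 0 < b - a := by linarith
  have h3 : (c - b) * f a + (b - a) * f c < 0 := by
    rcases hneg with h4 | h4 <;> nlinarith
  by_contra hcon
  nlinarith [mul_nonneg (by linarith : 0 ≤ c - a) (not_lt.1 hcon)]

/-- Data of the proposition: `γ > 0`, `μ γ < ∞`, and `μ δ < μ γ` for some `δ > γ`. -/
structure SpectralHypothesis (P : Measure Ω) (A : Fin N → Ω → ℝ) (γ δ : ℝ) : Prop where
  pos : 0 < γ
  lt : γ < δ
  finite : momentSum P A γ < ⊤
  finite' : momentSum P A δ < ⊤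
  gap_neg : gap P A γ δ < 0

variable {γ δ : ℝ}

/-- A zero of the gap left of γ, together with the negative value at δ, would make the gap negative
at γ; between γ and δ the gap is negative by convexity. -/
lemma SpectralHypothesis.lt_of_mem_otherRoots (h : SpectralHypothesis P A γ δ)
    (hA : StandingAssumptions P A) {q : ℝ} (hq : q ∈ otherRoots P A γ) :
    δ < q ∧ momentSum P A q < ⊤ ∧ gap P A γ q = 0 := by
  obtain ⟨hq0, hqγ, hqe⟩ := hq
  obtain ⟨hfin, hgap⟩ := (spectral_eq_iff h.pos hq0 h.finite).1 hqe
  refine ⟨?_, hfin, hgap⟩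
  by_contra hcon
  have hδ := h.gap_neg
  rcases lt_or_gt_of_ne hqγ with h1 | h1
  · have := (convexOn_gap hA γ).neg_of_lt_of_lt hfin h.finite' h1 h.lt hgap.le hδ.le (Or.inr hδ)
    rw [gap_self h.pos.ne'] at this
    exact lt_irrefl _ this
  · rcases (not_lt.1 hcon).eq_or_lt with rfl | h2
    · linarith
    · have := (convexOn_gap hA γ).neg_of_lt_of_lt h.finite h.finite' h1 h2
        (gap_self h.pos.ne').le hδ.le (Or.inr hδ)
      linarith

/-- Of two roots beyond δ, the smaller lies between δ, where the gap is negative, and the larger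
root, so the gap would be negative there. -/
lemma SpectralHypothesis.subsingleton_otherRoots (h : SpectralHypothesis P A γ δ)
    (hA : StandingAssumptions P A) : (otherRoots P A γ).Subsingleton := by
  have key : ∀ q ∈ otherRoots P A γ, ∀ r ∈ otherRoots P A γ, ¬ q < r := by
    intro q hq r hr hlt
    obtain ⟨h1, h2, h3⟩ := h.lt_of_mem_otherRoots hA hq
    obtain ⟨-, h5, h6⟩ := h.lt_of_mem_otherRoots hA hr
    have := (convexOn_gap hA γ).neg_of_lt_of_lt h.finite' h5 h1 hlt h.gap_neg.le h6.le
      (Or.inl h.gap_neg)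
    linarith
  intro q hq r hr
  exact le_antisymm (not_lt.1 (key r hr q hq)) (not_lt.1 (key q hq r hr))

/-- Convexity gives continuity only in the interior, whereas b may be the end of the domain of
finiteness. Dominated convergence with A^a + A^b reaches the endpoints. -/
lemma continuousOn_gap (hA : StandingAssumptions P A) {a b : ℝ} (ha : 0 < a)
    (hfa : momentSum P A a < ⊤) (hfb : momentSum P A b < ⊤) (hab : a ≤ b) :
    ContinuousOn (gap P A γ) (Set.Icc a b) := by
  have hm := hA.measurable
  have hb : 0 < b := ha.trans_le hab
  have hcont : ContinuousOn (fun s => ∫ ω, ∑ j, A j ω ^ s ∂P) (Set.Icc a b) := by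
    refine continuousOn_of_dominated (bound := fun ω => ∑ j, A j ω ^ a + ∑ j, A j ω ^ b)
      (fun s _ => Measurable.aestronglyMeasurable (by fun_prop))
      (fun s hs => Filter.Eventually.of_forall fun ω => ?_)
      ((integrable_sum_rpow hA ha.ne' hfa).add (integrable_sum_rpow hA hb.ne' hfb))
      (Filter.Eventually.of_forall fun ω => ?_)
    · rw [Real.norm_of_nonneg (Finset.sum_nonneg fun i _ => Real.rpow_nonneg (hA.nonneg i ω) s),
        ← Finset.sum_add_distrib]
      refine Finset.sum_le_sum fun j _ => ?_
      have h0 := Real.rpow_nonneg (hA.nonneg j ω) a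
      have h1 := Real.rpow_nonneg (hA.nonneg j ω) b
      rcases (hA.nonneg j ω).eq_or_lt with hz | hz
      · rw [← hz, Real.zero_rpow (ha.trans_le hs.1).ne']
        rw [← hz] at h0 h1
        linarith
      · rcases le_total (A j ω) 1 with h2 | h2
        · linarith [Real.rpow_le_rpow_of_exponent_ge hz h2 hs.1]
        · linarith [Real.rpow_le_rpow_of_exponent_le h2 hs.2]
    · refine continuousOn_finsetSum _ fun j _ => ?_
      rcases (hA.nonneg j ω).eq_or_lt with hz | hz
      · refine continuousOn_const (c := (0 : ℝ)) |>.congr fun s hs => ?_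
        simp only [← hz]
        exact Real.zero_rpow (ha.trans_le hs.1).ne'
      · exact (Real.continuous_const_rpow hz.ne').continuousOn
  have hcongr : ContinuousOn (fun s => (momentSum P A s).toReal) (Set.Icc a b) :=
    hcont.congr fun s hs => toReal_momentSum hA (ha.trans_le hs.1).ne'
  exact (hcongr.sub continuousOn_const).sub (continuousOn_id.mul continuousOn_const)

/-- If the gap were non-negative at p, then p > δ and the intermediate value theorem would put a
root in [δ, p]. Conversely, a gap that vanishes at γ and is negative at p is negative in between, so
a root lies beyond p. -/
lemma SpectralHypothesis.lt_qStar_and_iff (h : SpectralHypothesis P A γ δ)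
    (hA : StandingAssumptions P A) {p : ℝ} (hp : γ < p) :
    ((p : EReal) < qStar P A γ ∧ spectral P A p < ⊤) ↔ spectral P A p < spectral P A γ := by
  have hp0 : 0 < p := h.pos.trans hp
  have hδ0 : 0 < δ := h.pos.trans h.lt
  rw [spectral_lt_iff hp0 h.finite, spectral_lt_top_iff hp0]
  constructor
  · rintro ⟨hq, hfin⟩
    refine ⟨hfin, ?_⟩
    by_contra hcon
    rw [not_lt] at hcon
    have hroot : ∀ q, δ ≤ q → q ≤ p → momentSum P A q < ⊤ → gap P A γ q = 0 → False := by
      intro q h1 h2 h3 h4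
      have hmem : q ∈ otherRoots P A γ := ⟨hδ0.trans_le h1, (h.lt.trans_le h1).ne',
        (spectral_eq_iff h.pos (hδ0.trans_le h1) h.finite).2 ⟨h3, h4⟩⟩
      have : qStar P A γ ≤ q := sInf_le ⟨q, hmem, rfl⟩
      exact absurd (hq.trans_le this) (not_lt.2 (by exact_mod_cast h2))
    rcases lt_trichotomy p δ with h1 | h1 | h1
    · have := (convexOn_gap hA γ).neg_of_lt_of_lt h.finite h.finite' hp h1
        (gap_self h.pos.ne').le h.gap_neg.le (Or.inr h.gap_neg)
      linarith
    · have := h.gap_neg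
      rw [← h1] at this
      linarith
    · obtain ⟨q, hqI, hq0⟩ := intermediate_value_Icc h1.le
        (continuousOn_gap hA (γ := γ) hδ0 h.finite' hfin h1.le)
        (show (0 : ℝ) ∈ Set.Icc (gap P A γ δ) (gap P A γ p) from ⟨h.gap_neg.le, hcon⟩)
      exact hroot q hqI.1 hqI.2
        ((convexOn_gap hA γ).1.ordConnected.out h.finite' hfin hqI) hq0
  · rintro ⟨hfin, hneg⟩
    refine ⟨?_, hfin⟩
    rcases (h.subsingleton_otherRoots hA).eq_empty_or_singleton with he | ⟨q, he⟩
    · rw [qStar, he, Set.image_empty, sInf_empty]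
      exact EReal.coe_lt_top p
    · rw [qStar, he, Set.image_singleton, sInf_singleton, EReal.coe_lt_coe_iff]
      obtain ⟨h1, h2, h3⟩ := h.lt_of_mem_otherRoots hA (q := q) (by rw [he]; rfl)
      by_contra hcon
      rcases (not_lt.1 hcon).eq_or_lt with rfl | h4
      · linarith
      · have := (convexOn_gap hA γ).neg_of_lt_of_lt h.finite hfin (h.lt.trans h1) h4
          (gap_self h.pos.ne').le hneg.le (Or.inr hneg)
        linarith

end Spectral

open SmoothingTransform

/-! ### The weights A_i^γ τ^{Q(γ)} and the translation of the integral equation. -/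

section Weights

variable {Ω : Type*} [MeasurableSpace Ω] {N : ℕ} {P : Measure Ω} {A : Fin N → Ω → ℝ} {γ δ : ℝ}

/-- The uniform distribution on `(0, 1]`. -/
noncomputable def uniformMeasure : Measure ℝ := volume.restrict (Set.Ioc 0 1)

instance isProbabilityMeasure_uniformMeasure : IsProbabilityMeasure uniformMeasure := ⟨by simp [uniformMeasure]⟩

lemma ae_uniformMeasure : ∀ᵐ τ ∂uniformMeasure, τ ∈ Set.Ioc (0 : ℝ) 1 :=
  ae_restrict_mem measurableSet_Ioc

lemma lintegral_rpow_uniformMeasure {r : ℝ} (hr : -1 < r) :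
    ∫⁻ τ, ENNReal.ofReal (|τ| ^ r) ∂uniformMeasure = ENNReal.ofReal (1 / (r + 1)) := by
  have hint : Integrable (fun τ : ℝ => τ ^ r) uniformMeasure :=
    (intervalIntegrable_iff_integrableOn_Ioc_of_le zero_le_one).1
      (intervalIntegral.intervalIntegrable_rpow' hr)
  have h1 : ∫⁻ τ, ENNReal.ofReal (|τ| ^ r) ∂uniformMeasure
      = ∫⁻ τ, ENNReal.ofReal (τ ^ r) ∂uniformMeasure := by
    refine lintegral_congr_ae ?_
    filter_upwards [ae_uniformMeasure] with τ hτ using by rw [abs_of_pos hτ.1]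
  rw [h1, ← ofReal_integral_eq_lintegral_ofReal hint, uniformMeasure,
    ← intervalIntegral.integral_of_le zero_le_one, integral_rpow (Or.inl hr), Real.one_rpow,
    Real.zero_rpow (by linarith), sub_zero]
  filter_upwards [ae_uniformMeasure] with τ hτ using Real.rpow_nonneg hτ.1.le r

lemma lintegral_rpow_uniformMeasure_eq_top {r : ℝ} (hr : r ≤ -1) :
    ∫⁻ τ, ENNReal.ofReal (|τ| ^ r) ∂uniformMeasure = ⊤ := by
  by_contra hcon
  have hfin : Integrable (fun τ : ℝ => |τ| ^ r) uniformMeasure := by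
    refine ⟨Measurable.aestronglyMeasurable (by fun_prop), ?_⟩
    rw [hasFiniteIntegral_iff_ofReal
      (Filter.Eventually.of_forall fun τ => Real.rpow_nonneg (abs_nonneg τ) r)]
    exact lt_top_iff_ne_top.2 hcon
  have h1 : IntegrableOn (fun τ : ℝ => τ ^ r) (Set.Ioc 0 1) := by
    refine Integrable.congr hfin ?_
    filter_upwards [ae_uniformMeasure] with τ hτ using by rw [abs_of_pos hτ.1]
  have h2 := (intervalIntegral.integrableOn_Ioo_rpow_iff (s := r) zero_lt_one).1
    (h1.mono_set Set.Ioo_subset_Ioc_self)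
  linarith

/-- The weights `A i ^ γ * τ ^ Q γ` of the smoothing transform, on `Ω × (0, 1]`. -/
noncomputable def weights (P : Measure Ω) (A : Fin N → Ω → ℝ) (γ : ℝ) (i : Fin N) (x : Ω × ℝ) :
    ℝ :=
  -- The absolute value keeps the weights non-negative for every real τ; it has no effect on (0, 1].
  A i x.1 ^ γ * |x.2| ^ (Q P A γ).toReal

lemma measurable_weights (hA : StandingAssumptions P A) (i : Fin N) :
    Measurable (weights P A γ i) := by
  have := hA.measurable
  unfold weights
  fun_prop

lemma weights_nonneg (hA : StandingAssumptions P A) (i : Fin N) (x : Ω × ℝ) :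
    0 ≤ weights P A γ i x :=
  mul_nonneg (Real.rpow_nonneg (hA.nonneg i _) _) (Real.rpow_nonneg (abs_nonneg _) _)

lemma weightMoment_weights [IsProbabilityMeasure P] (hA : StandingAssumptions P A) {s : ℝ}
    (hs : γ * s ≠ 0) :
    weightMoment (P.prod uniformMeasure) (weights P A γ) s = momentSum P A (γ * s)
      * ∫⁻ τ, ENNReal.ofReal (|τ| ^ ((Q P A γ).toReal * s)) ∂uniformMeasure := by
  have hm := hA.measurable
  rw [momentSum_eq hA hs, weightMoment, ← lintegral_prod_mul (by fun_prop) (by fun_prop)]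
  refine lintegral_congr fun x => ?_
  rw [Finset.sum_mul]
  refine Finset.sum_congr rfl fun i _ => ?_
  rw [weights, Real.mul_rpow (Real.rpow_nonneg (hA.nonneg i _) _)
    (Real.rpow_nonneg (abs_nonneg _) _), ← Real.rpow_mul (hA.nonneg i _),
    ← Real.rpow_mul (abs_nonneg _), ENNReal.ofReal_mul (Real.rpow_nonneg (hA.nonneg i _) _)]

lemma toReal_Q (h : momentSum P A γ < ⊤) :
    (Q P A γ).toReal = (momentSum P A γ).toReal - 1 := by
  rw [Q_eq_coe h, EReal.toReal_coe]

lemma toReal_momentSum_pos [IsProbabilityMeasure P] (hA : StandingAssumptions P A) {s : ℝ}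
    (hs : s ≠ 0) (h : momentSum P A s < ⊤) : 0 < (momentSum P A s).toReal :=
  ENNReal.toReal_pos (momentSum_ne_zero hA hs) h.ne

lemma isNormalizedWeights [IsProbabilityMeasure P] (hA : StandingAssumptions P A) (hγ : γ ≠ 0)
    (h : momentSum P A γ < ⊤) :
    IsNormalizedWeights (P.prod uniformMeasure) (weights P A γ) where
  measurable := measurable_weights hA
  nonneg := weights_nonneg hA
  weightMoment_one := by
    have hpos := toReal_momentSum_pos hA hγ h
    rw [weightMoment_weights hA (by simpa using hγ), mul_one, mul_one, toReal_Q h,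
      lintegral_rpow_uniformMeasure (by linarith), sub_add_cancel, one_div,
      ENNReal.ofReal_inv_of_pos hpos, ENNReal.ofReal_toReal h.ne,
      ENNReal.mul_inv_cancel (momentSum_ne_zero hA hγ) h.ne]

/-- With r = p μ(γ) > -1 the weight moment is (Q(p) + 1)/(r + 1), which is below 1 exactly when Q(p)
< p μ(γ). -/
lemma weightMoment_lt_one_iff [IsProbabilityMeasure P] (hA : StandingAssumptions P A)
    (hγ : 0 < γ) (h : momentSum P A γ < ⊤) {p : ℝ} (hp : 0 < p) :
    weightMoment (P.prod uniformMeasure) (weights P A γ) (p / γ) < 1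
      ↔ spectral P A p < spectral P A γ := by
  have hp' : γ * (p / γ) = p := by field_simp
  rw [weightMoment_weights hA (by rw [hp']; exact hp.ne'), hp', toReal_Q h,
    spectral_lt_iff hp h]
  set r := ((momentSum P A γ).toReal - 1) * (p / γ) with hr
  have hgap : gap P A γ p = (momentSum P A p).toReal - (r + 1) := by
    rw [gap, hr]; field_simp; ring
  rw [hgap]
  rcases lt_or_ge (-1) r with h1 | h1
  · have h2 : 0 < r + 1 := by linarith
    rw [lintegral_rpow_uniformMeasure h1, one_div, ENNReal.ofReal_inv_of_pos h2, ← div_eq_mul_inv,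
      ENNReal.div_lt_iff (Or.inl (by simpa using h2)) (Or.inl ENNReal.ofReal_ne_top), one_mul]
    constructor
    · intro h3
      have h4 := h3.trans ENNReal.ofReal_lt_top
      refine ⟨h4, ?_⟩
      have := (ENNReal.lt_ofReal_iff_toReal_lt h4.ne).1 h3
      linarith
    · rintro ⟨h3, h4⟩
      exact (ENNReal.lt_ofReal_iff_toReal_lt h3.ne).2 (by linarith)
  -- For r ≤ -1 both sides fail: the τ-integral is infinite, and the gap is at least E ∑ A_j^p > 0
  -- when that is finite.
  · rw [lintegral_rpow_uniformMeasure_eq_top h1, ENNReal.mul_top (momentSum_ne_zero hA hp.ne')]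
    constructor
    · intro h2
      exact absurd h2 (not_lt.2 le_top)
    · rintro ⟨h2, h3⟩
      have := toReal_momentSum_pos hA hp.ne' h2
      linarith

lemma not_ae_at_most_one_weight_pos [IsProbabilityMeasure P] (hA : StandingAssumptions P A) :
    ¬ ∀ᵐ x ∂(P.prod uniformMeasure), ∀ i j, 0 < weights P A γ i x → 0 < weights P A γ j x →
      i = j := by
  intro hae
  refine hA.count_not_trivial.ne (measure_eq_one_of_ae ?_)
  filter_upwards [Measure.ae_ae_of_ae_prod hae] with ω hω
  obtain ⟨τ, hτ, hτ0⟩ := (hω.and ae_uniformMeasure).exists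
  have hw : ∀ i, 0 < A i ω → 0 < weights P A γ i (ω, τ) := fun i hi =>
    mul_pos (Real.rpow_pos_of_pos hi _) (Real.rpow_pos_of_pos (abs_pos.2 hτ0.1.ne') _)
  by_cases hex : ∃ i, 0 < A i ω
  · obtain ⟨i, hi⟩ := hex
    right
    rw [posCount, Finset.sum_eq_single i]
    · rw [if_pos hi]
    · intro j _ hji
      rw [if_neg]
      exact fun hj => hji (hτ j i (hw j hj) (hw i hi))
    · simp
  · left
    push Not at hex
    exact Finset.sum_eq_zero fun i _ => if_neg (not_lt.2 (hex i))

/-- By Fubini the right side of the equation is the characteristic function of the transformed law,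
and characteristic functions determine laws. -/
lemma solvesEq_charFun_iff [IsProbabilityMeasure P] (hA : StandingAssumptions P A)
    (ζ : Measure ℝ) [IsProbabilityMeasure ζ] :
    SolvesEq P A γ (charFun ζ) ↔ smoothing (P.prod uniformMeasure) (weights P A γ) ζ = ζ := by
  have hmw := measurable_weights (γ := γ) hA
  have hprob := isProbabilityMeasure_smoothing (P := P.prod uniformMeasure) hmw ζ
  have key : ∀ ξ : ℝ, ∫ τ in (0 : ℝ)..1,
      ∫ ω, ∏ i, charFun ζ (ξ * A i ω ^ γ * τ ^ (Q P A γ).toReal) ∂P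
      = charFun (smoothing (P.prod uniformMeasure) (weights P A γ) ζ) ξ := by
    intro ξ
    rw [charFun_smoothing hmw, integral_prod_symm,
      intervalIntegral.integral_of_le zero_le_one]
    · refine integral_congr_ae ?_
      filter_upwards [ae_uniformMeasure] with τ hτ
      refine integral_congr_ae (Filter.Eventually.of_forall fun ω => ?_)
      simp only [weights, abs_of_pos hτ.1, mul_assoc]
    · refine Integrable.of_bound (C := 1) (Measurable.aestronglyMeasurable (by fun_prop))
        (Filter.Eventually.of_forall fun x => ?_)
      rw [norm_prod]
      exact Finset.prod_le_one (fun i _ => norm_nonneg _) fun i _ => norm_charFun_le_one _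
  simp only [SolvesEq, key]
  exact ⟨fun h => Measure.ext_of_charFun (funext fun ξ => (h ξ).symm), fun h ξ => by rw [h]⟩

lemma isMeanOneSolution_iff [IsProbabilityMeasure P] (hA : StandingAssumptions P A)
    (ζ : Measure ℝ) :
    IsMeanOneSolution P A γ ζ ↔
      IsMeanOne ζ ∧ smoothing (P.prod uniformMeasure) (weights P A γ) ζ = ζ := by
  constructor
  · intro h
    have := h.isProbabilityMeasure
    have hnn : ∀ᵐ z ∂ζ, 0 ≤ z := by
      filter_upwards [measure_eq_zero_iff_ae_notMem.1 h.supported] with z hz using by simpa using hz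
    refine ⟨⟨this, hnn, ?_⟩, (solvesEq_charFun_iff hA ζ).1 h.solves⟩
    have h1 := ofReal_integral_eq_lintegral_ofReal h.integrable hnn
    rw [h.mean_eq_one, ENNReal.ofReal_one] at h1
    simp only [moment, Real.rpow_one]
    exact h1.symm
  · rintro ⟨h, hfix⟩
    have := h.isProbabilityMeasure
    refine ⟨this, ?_, h.integrable, h.integral_eq, (solvesEq_charFun_iff hA ζ).2 hfix⟩
    rw [measure_eq_zero_iff_ae_notMem]
    filter_upwards [h.nonneg] with z hz using by simpa using hz

lemma _root_.SmoothingTransform.smoothing_dirac_one_eq_iff {Ω' ι : Type*} [MeasurableSpace Ω']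
    [Fintype ι] {P' : Measure Ω'} [IsProbabilityMeasure P'] {T : ι → Ω' → ℝ}
    (hT : ∀ i, Measurable (T i)) :
    smoothing P' T (Measure.dirac 1) = Measure.dirac 1 ↔ ∀ᵐ x ∂P', ∑ i, T i x = 1 := by
  have hS : Measurable fun x => ∑ i, T i x := by fun_prop
  have hprob := isProbabilityMeasure_smoothing (P := P') hT (Measure.dirac 1)
  have hprob' := Measure.isProbabilityMeasure_map (μ := P') hS.aemeasurable
  have hmap : smoothing P' T (Measure.dirac 1) = P'.map fun x => ∑ i, T i x := by
    refine Measure.ext_of_charFun (funext fun ξ => ?_)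
    rw [charFun_smoothing hT, charFun_apply_real, integral_map hS.aemeasurable (by fun_prop)]
    refine integral_congr_ae (Filter.Eventually.of_forall fun x => ?_)
    simp only [charFun_dirac]
    rw [← Complex.exp_sum]
    congr 1
    push_cast
    rw [Finset.mul_sum, Finset.sum_mul]
    simp
  rw [hmap]
  constructor
  · intro h
    have h1 : ∀ᵐ z ∂(P'.map fun x => ∑ i, T i x), z = 1 := by
      rw [h]
      exact (ae_dirac_iff (measurableSet_singleton 1)).2 rfl
    exact ae_of_ae_map hS.aemeasurable h1
  · intro h
    rw [Measure.map_congr (g := fun _ => 1) h, Measure.map_const, measure_univ, one_smul]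

/-- Two points 0 < x < y in (0, 1] satisfying the equation give x^q = y^q, which forces q = 0. -/
lemma eq_one_of_ae_mul_rpow_eq_one {S q : ℝ} (h : ∀ᵐ τ ∂uniformMeasure, S * |τ| ^ q = 1) :
    S = 1 := by
  have hmem : ∀ a b : ℝ, 0 ≤ a → a < b → b ≤ 1 →
      ∃ τ ∈ Set.Ioc a b, S * |τ| ^ q = 1 := by
    intro a b ha hab hb
    have h1 : ∀ᵐ τ ∂(volume.restrict (Set.Ioc a b)), S * |τ| ^ q = 1 :=
      ae_restrict_of_ae_restrict_of_subset (Set.Ioc_subset_Ioc ha hb) h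
    have hne : (ae (volume.restrict (Set.Ioc a b))).NeBot := by
      rw [ae_restrict_neBot]
      simpa using hab
    exact ((ae_restrict_mem measurableSet_Ioc).and h1).exists
  obtain ⟨x, hx, hxS⟩ := hmem 0 (1 / 2) le_rfl (by norm_num) (by norm_num)
  obtain ⟨y, hy, hyS⟩ := hmem (1 / 2) 1 (by norm_num) (by norm_num) le_rfl
  have hx0 : 0 < x := hx.1
  have hxy : x < y := hx.2.trans_lt hy.1
  have hy0 : 0 < y := hx0.trans hxy
  rw [abs_of_pos hx0] at hxS
  rw [abs_of_pos hy0] at hyS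
  have hS0 : S ≠ 0 := by
    rintro rfl
    simp at hxS
  have heq : x ^ q = y ^ q := mul_left_cancel₀ hS0 (hxS.trans hyS.symm)
  have hq : q = 0 := by
    rcases lt_trichotomy q 0 with hq | hq | hq
    · exact absurd heq (Real.rpow_lt_rpow_of_neg hx0 hxy hq).ne'
    · exact hq
    · exact absurd heq (Real.rpow_lt_rpow hx0.le hxy hq).ne
  simpa [hq] using hxS

lemma ae_sum_weights_eq_one_iff [IsProbabilityMeasure P] (hA : StandingAssumptions P A)
    (hγ : γ ≠ 0) (h : momentSum P A γ < ⊤) :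
    (∀ᵐ x ∂(P.prod uniformMeasure), ∑ i, weights P A γ i x = 1)
      ↔ ∀ᵐ ω ∂P, ∑ i, A i ω ^ γ = 1 := by
  simp only [weights, ← Finset.sum_mul]
  constructor
  · intro hae
    filter_upwards [Measure.ae_ae_of_ae_prod hae] with ω hω
    exact eq_one_of_ae_mul_rpow_eq_one hω
  · intro hae
    -- Taking expectations of ∑ A_i^γ = 1 gives Q(γ) = 0, so the factor in τ is 1.
    have hQ : (Q P A γ).toReal = 0 := by
      rw [toReal_Q h, toReal_momentSum hA hγ, integral_congr_ae hae]
      simp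
    rw [hQ]
    have h1 : ∀ᵐ x ∂(P.prod uniformMeasure), ∑ i, A i x.1 ^ γ = 1 :=
      Measure.quasiMeasurePreserving_fst.ae hae
    filter_upwards [h1] with x hx
    simpa using hx

lemma exists_spectralHypothesis (hγ0 : 0 < γ)
    (hδ : ∃ δ : ℝ, γ < δ ∧ spectral P A δ < spectral P A γ) (hfin : spectral P A γ < ⊤) :
    ∃ δ, SpectralHypothesis P A γ δ := by
  obtain ⟨δ, hγδ, hlt⟩ := hδ
  have hγ := (spectral_lt_top_iff hγ0).1 hfin
  obtain ⟨h1, h2⟩ := (spectral_lt_iff (hγ0.trans hγδ) hγ).1 hlt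
  exact ⟨δ, hγ0, hγδ, hγ, h1, h2⟩

end Weights

end KacLike

theorem proposition1 {Ω : Type*} [MeasurableSpace Ω] (P : MeasureTheory.Measure Ω)
    [MeasureTheory.IsProbabilityMeasure P] {N : ℕ} (A : Fin N → Ω → ℝ)
    (hA : KacLike.StandingAssumptions P A)
    (γ : ℝ) (hγ0 : 0 < γ) (hγ2 : γ ≤ 2)
    (hδ : ∃ δ : ℝ, γ < δ ∧ KacLike.spectral P A δ < KacLike.spectral P A γ)
    (hfin : KacLike.spectral P A γ < ⊤) :
    (∃! ζ : MeasureTheory.Measure ℝ, KacLike.IsMeanOneSolution P A γ ζ) ∧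
    (KacLike.otherRoots P A γ).Subsingleton ∧
    ∀ ζ : MeasureTheory.Measure ℝ, KacLike.IsMeanOneSolution P A γ ζ →
      ((∃ c : ℝ, ζ = MeasureTheory.Measure.dirac c) ↔ ∀ᵐ ω ∂P, ∑ i, A i ω ^ γ = 1) ∧
      (P {ω | ∑ i, A i ω ^ γ = 1} < 1 → ∀ p : ℝ, γ < p →
        (∫⁻ z, ENNReal.ofReal (z ^ (p / γ)) ∂ζ < ⊤ ↔
          (p : EReal) < KacLike.qStar P A γ ∧ KacLike.spectral P A p < ⊤)) := by
  obtain ⟨δ, h⟩ := KacLike.exists_spectralHypothesis hγ0 hδ hfin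
  have hT := KacLike.isNormalizedWeights hA hγ0.ne' h.finite
  have hs : 1 < δ / γ := (one_lt_div hγ0).2 h.lt
  have hδ0 : 0 < δ := hγ0.trans h.lt
  have hw := (KacLike.weightMoment_lt_one_iff hA hγ0 h.finite hδ0).2
    ((KacLike.spectral_lt_iff hδ0 h.finite).2 ⟨h.finite', h.gap_neg⟩)
  obtain ⟨ζ₀, h0, hfix0, hmom0⟩ := SmoothingTransform.exists_isMeanOne_smoothing_eq hT hs hw
  have huniq : ∀ ζ, KacLike.IsMeanOneSolution P A γ ζ → ζ = ζ₀ := by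
    intro ζ hζ
    obtain ⟨h1, h2⟩ := (KacLike.isMeanOneSolution_iff hA ζ).1 hζ
    exact h1.eq_of_smoothing_eq hT hs hw h0 h2 hfix0
  refine ⟨⟨ζ₀, (KacLike.isMeanOneSolution_iff hA ζ₀).2 ⟨h0, hfix0⟩, huniq⟩,
    h.subsingleton_otherRoots hA, ?_⟩
  intro ζ hζ
  obtain rfl := huniq ζ hζ
  refine ⟨?_, fun _ p hp => ?_⟩
  · rw [← KacLike.ae_sum_weights_eq_one_iff hA hγ0.ne' h.finite,
      ← SmoothingTransform.smoothing_dirac_one_eq_iff hT.measurable]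
    constructor
    -- The mean of a point mass at c is c, hence c = 1.
    · rintro ⟨c, rfl⟩
      have hc := h0.integral_eq
      rw [MeasureTheory.integral_dirac] at hc
      rw [← hc]
      exact hfix0.trans (by rw [hc])
    · intro hdirac
      exact ⟨1, h0.eq_of_smoothing_eq hT hs hw SmoothingTransform.isMeanOne_dirac_one hfix0 hdirac⟩
  · rw [h.lt_qStar_and_iff hA hp, ← KacLike.weightMoment_lt_one_iff hA hγ0 h.finite
      (hγ0.trans hp)]
    have hp1 : 1 < p / γ := (one_lt_div hγ0).2 hp
    exact ⟨fun hm => SmoothingTransform.weightMoment_lt_one_of_moment_lt_top hT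
      (KacLike.not_ae_at_most_one_weight_pos hA) h0 hfix0 hp1 hm, hmom0 _ hp1⟩
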